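/- Let $R$ be a commutative ring; modules are $R$-modules. A module $M$ is Mittag-Leffler if for every family of modules $(N_i)_{i\in I}$ the canonical map $M\otimes_R\prod_{i}N_i\to\prod_{i}(M\otimes_R N_i)$ is injective. For an infinite cardinal $\kappa$, a module is $\le\kappa$-presented if it is the cokernel of a homomorphism between free modules of rank $\le\kappa$. Let $\mathcal A(\kappa)$ be the class of $\kappa$-restricted flat Mittag-Leffler modules, i.e. of modules $M$ that admit a chain of submodules $(M_\alpha\mid\alpha\le\sigma)$, indexed by an ordinal $\sigma$, with $M_\alpha\subseteq M_\beta$ for $\alpha\le\beta\le\sigma$, $M_0=0$, $M_\sigma=M$, $M_\beta=\bigcup_{\alpha<\beta}M_\alpha$ for limit ordinals $\beta\le\sigma$, and $M_{\alpha+1}/M_\alpha$ a $\le\kappa$-presented flat Mittag-Leffler module for every $\alpha<\sigma$. For a class $\mathcal C$ of modules, a module $M$ is $\mathcal C$-periodic if there is a short exact sequence $0\to M\to C\to M\to 0$ with $C\in\mathcal C$. A ($\mathbb Z$-indexed) chain complex $C_\bullet$ with cycles $Z_n=\operatorname{Ker}(C_n\to C_{n-1})$ is pure acyclic if it is acyclic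 and every $Z_n$ is a pure submodule of $C_n$ (i.e. $N\otimes_R Z_n\to N\otimes_R C_n$ is injective for every module $N$). For every infinite cardinal $\kappa$: 1. every flat $\mathcal A(\kappa)$-periodic module belongs to $\mathcal A(\kappa)$; 2. every pure acyclic complex with all components in $\mathcal A(\kappa)$ has all its cycles in $\mathcal A(\kappa)$. Moreover, $\mathcal A(\aleph_0)$ is exactly the class of projective modules. Hence (Benson–Goodearl) every flat module $M$ that admits a short exact sequence $0\to M\to P\to M\to 0$ with $P$ projective is projective, and every pure acyclic complex of projective modules has projective cycles and is contractible. -/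

import Mathlib

open CategoryTheory
open scoped TensorProduct Cardinal

universe u

namespace RestrictedFlatML

variable (R : Type u) [CommRing R]

/-- `M` is Mittag-Leffler: for every family of modules `(N i)`, the canonical map
`M ⊗ ∏ i, N i → ∏ i, M ⊗ N i` is injective. -/
def IsMittagLeffler (M : Type u) [AddCommGroup M] [Module R M] : Prop :=
  ∀ (I : Type u) (N : I → Type u) [∀ i, AddCommGroup (N i)] [∀ i, Module R (N i)],
    Function.Injective (TensorProduct.piRightHom R R M N)

/-- `M` is `≤ κ`-presented: it is the cokernel of a map between free modules of rank `≤ κ`. -/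
def IsLEPresented (κ : Cardinal.{u}) (M : Type u) [AddCommGroup M] [Module R M] : Prop :=
  ∃ (I J : Type u) (f : (J →₀ R) →ₗ[R] (I →₀ R)) (g : (I →₀ R) →ₗ[R] M),
    #I ≤ κ ∧ #J ≤ κ ∧ Function.Exact f g ∧ Function.Surjective g

/-- The class of flat modules. -/
def flatModules : ObjectProperty (ModuleCat.{u} R) :=
  fun M => Module.Flat R M

/-- The class of projective modules. -/
def projectiveModules : ObjectProperty (ModuleCat.{u} R) :=
  fun M => Module.Projective R M

/-- The class of `≤ κ`-presented flat Mittag-Leffler modules. -/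
def presentedFlatML (κ : Cardinal.{u}) : ObjectProperty (ModuleCat.{u} R) :=
  fun M => IsLEPresented R κ M ∧ Module.Flat R M ∧ IsMittagLeffler R M

variable {R}

/-- The class of `S`-filtered modules: `M` is the union of a continuous well-ordered chain
`(F α | α ≤ σ)` of submodules starting at `0` whose consecutive factors are isomorphic
to modules in `S`. -/
def filt (S : ObjectProperty (ModuleCat.{u} R)) : ObjectProperty (ModuleCat.{u} R) :=
  fun M => ∃ (σ : Ordinal.{u}) (F : Ordinal.{u} → Submodule R M),
    MonotoneOn F (Set.Iic σ) ∧ F 0 = ⊥ ∧ F σ = ⊤ ∧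
    (∀ β ≤ σ, Order.IsSuccLimit β → F β = ⨆ α : Set.Iio β, F α) ∧
    ∀ α < σ, ∃ N : ModuleCat.{u} R, S N ∧
      Nonempty ((F (Order.succ α) ⧸ (F α).submoduleOf (F (Order.succ α))) ≃ₗ[R] N)

variable (R) in
/-- The class `A(κ)` of `κ`-restricted flat Mittag-Leffler modules: modules filtered by
`≤ κ`-presented flat Mittag-Leffler modules. -/
def restrictedFlatML (κ : Cardinal.{u}) : ObjectProperty (ModuleCat.{u} R) :=
  filt (presentedFlatML R κ)

/-- `M` is `A`-periodic: there is a short exact sequence `0 → M → C → M → 0` with `C` in `A`. -/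
def IsPeriodic (A : ObjectProperty (ModuleCat.{u} R)) (M : ModuleCat.{u} R) : Prop :=
  ∃ (C : ModuleCat.{u} R) (f : M →ₗ[R] C) (g : C →ₗ[R] M),
    A C ∧ Function.Injective f ∧ Function.Exact f g ∧ Function.Surjective g

/-- `P` is a pure submodule of `M`: tensoring the inclusion with any module keeps it injective. -/
def IsPureSubmodule {M : Type u} [AddCommGroup M] [Module R M] (P : Submodule R M) : Prop :=
  ∀ (N : Type u) [AddCommGroup N] [Module R N], Function.Injective (P.subtype.lTensor N)

/-- The module of `n`-cycles `Z n = Ker (d n : C n → C (n - 1))`, as a submodule of `C n`. -/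
def cycles (C : ChainComplex (ModuleCat.{u} R) ℤ) (n : ℤ) : Submodule R (C.X n) :=
  LinearMap.ker (C.d n (n - 1)).hom

/-- A complex is pure acyclic if it is acyclic and all the short exact sequences
`0 → Z n → C n → Z (n - 1) → 0` are pure. -/
def IsPureAcyclic (C : ChainComplex (ModuleCat.{u} R) ℤ) : Prop :=
  C.Acyclic ∧ ∀ n, IsPureSubmodule (cycles C n)

end RestrictedFlatML

-- Both periodicity statements are one statement about a sequence of short exact sequences `0 → Z (n
-- + 1) → C (n + 1) → Z n → 0`, `n ∈ ℤ`, with flat `Z n`: if all `C n` are filtered by `≤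
-- κ`-presented flat Mittag-Leffler modules, then so are all `Z n` (`IsSpliced.restrictedFlatML`). A
-- periodic module gives the constant sequence, and a pure acyclic complex gives the sequence of its
-- cycles.
--
-- Since `Z (n - 1)` is flat, `Z n` is pure in `C n`, hence flat Mittag-Leffler. The filtration of
-- the `Z n` comes from exhausting the whole sequence by subsequences `D n ⊆ C n` with `D n ∩ Z n =
-- p (D (n + 1))`, each step adding only `κ` generators. The Hill lemma (`exists_isHillFamily`)
-- provides many submodules of `C n` with flat Mittag-Leffler quotient, closed under arbitrary sums,
-- so that after dividing by what has been reached the situation repeats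
-- (`IsGoodFamily.exists_next`), and unions are harmless at limits.
--
-- The difficulty is that `R` may have more than `κ` elements, so a subsequence generated by `κ`
-- elements cannot be found by closing under operations on all its elements. The Mittag-Leffler
-- property replaces this by a closure over finite sets of generators: for a free module mapping
-- onto a flat Mittag-Leffler module by `π`, each finite set `s` of basis vectors has an
-- endomorphism `φ` with `π φ = π` on `s` which kills all relations supported on `s`
-- (`IsFlatML.exists_endomorphism`). So the elements `y - φ y` generate these relations, there are
-- only `κ` of them over a basis of size `κ`, and lifting them yields exactness and flatness of the
-- subsequence (`IsSpliced.exists_subsequence`). The same fact shows that `κ`-generated flat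
-- Mittag-Leffler modules are `≤ κ`-presented.
--
-- For `κ = ℵ₀`, countably generated flat Mittag-Leffler modules are projective
-- (`IsFlatML.projective_of_countable`) and extensions along a filtration by projectives split.
-- Conversely, a projective module is a cycle in an exact sequence of free modules with alternating
-- idempotents as differentials, to which the general result applies.

universe v

namespace RestrictedFlatML

/-! ### Pure monomorphisms, and flat Mittag-Leffler modules under pure submodules and extensions. -/

section Purity

variable {R : Type u} [CommRing R]
variable {A B Q : Type u} [AddCommGroup A] [Module R A] [AddCommGroup B] [Module R B]
  [AddCommGroup Q] [Module R Q]

/-- A linear map is a pure monomorphism if it stays injective after tensoring with any module. -/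
def IsPureInjective (f : A →ₗ[R] B) : Prop :=
  ∀ (N : Type u) [AddCommGroup N] [Module R N], Function.Injective (f.rTensor N)

theorem isPureSubmodule_iff {P : Submodule R B} :
    IsPureSubmodule P ↔ IsPureInjective P.subtype := by
  unfold IsPureSubmodule IsPureInjective
  simp only [LinearMap.lTensor_inj_iff_rTensor_inj]

theorem IsPureInjective.comp {f : A →ₗ[R] B} {g : B →ₗ[R] Q} (hg : IsPureInjective g)
    (hf : IsPureInjective f) : IsPureInjective (g ∘ₗ f) := by
  intro N _ _
  rw [LinearMap.rTensor_comp]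
  exact (hg N).comp (hf N)

theorem IsPureInjective.of_comp {f : A →ₗ[R] B} {g : B →ₗ[R] Q}
    (h : IsPureInjective (g ∘ₗ f)) : IsPureInjective f := by
  intro N _ _
  have := h N
  rw [LinearMap.rTensor_comp] at this
  exact Function.Injective.of_comp this

theorem IsPureInjective.of_leftInverse {f : A →ₗ[R] B} {g : B →ₗ[R] A}
    (h : g ∘ₗ f = LinearMap.id) : IsPureInjective f := by
  apply IsPureInjective.of_comp (g := g)
  intro N _ _
  rw [h, LinearMap.rTensor_id]
  exact Function.injective_id

/-- This is `Tor₁(Q, N) = 0` by a diagram chase on the tensor product of the two short exact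
sequences: a kernel element is lifted to `A ⊗ F`, and its image in `B ⊗ F` comes from `B ⊗ K` and
then, as `Q` is flat, from `A ⊗ K`. -/
theorem rTensor_injective_of_flat {f : A →ₗ[R] B} {g : B →ₗ[R] Q} (hf : Function.Injective f)
    (hfg : Function.Exact f g) (hg : Function.Surjective g) [Module.Flat R Q]
    {K F N : Type u} [AddCommGroup K] [Module R K] [AddCommGroup F] [Module R F] [Module.Flat R F]
    [AddCommGroup N] [Module R N] {ι : K →ₗ[R] F} {π : F →ₗ[R] N} (hι : Function.Injective ι)
    (hιπ : Function.Exact ι π) (hπ : Function.Surjective π) :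
    Function.Injective (f.rTensor N) := by
  rw [injective_iff_map_eq_zero]
  intro x hx
  obtain ⟨y, rfl⟩ := LinearMap.lTensor_surjective A hπ x
  have h1 : π.lTensor B (f.rTensor _ y) = 0 := by
    rw [← hx, ← LinearMap.comp_apply, ← LinearMap.comp_apply, LinearMap.lTensor_comp_rTensor,
      LinearMap.rTensor_comp_lTensor]
  obtain ⟨k, hk⟩ := (lTensor_exact B hιπ hπ _).1 h1
  have h2 : g.rTensor _ k = 0 := by
    apply Module.Flat.lTensor_preserves_injective_linearMap (M := Q) ι hι
    rw [map_zero, ← LinearMap.comp_apply, LinearMap.lTensor_comp_rTensor,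
      ← LinearMap.rTensor_comp_lTensor, LinearMap.comp_apply, hk, ← LinearMap.comp_apply,
      ← LinearMap.rTensor_comp, hfg.linearMap_comp_eq_zero, LinearMap.rTensor_zero,
      LinearMap.zero_apply]
  obtain ⟨a, rfl⟩ := (rTensor_exact _ hfg hg _).1 h2
  have h3 : ι.lTensor A a = y := by
    apply Module.Flat.rTensor_preserves_injective_linearMap (M := F) f hf
    rw [← hk, ← LinearMap.comp_apply, ← LinearMap.comp_apply, LinearMap.lTensor_comp_rTensor,
      LinearMap.rTensor_comp_lTensor]
  rw [← h3]
  exact (lTensor_exact A hιπ hπ _).2 ⟨a, rfl⟩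

theorem IsPureInjective.of_flat {f : A →ₗ[R] B} {g : B →ₗ[R] Q} (hf : Function.Injective f)
    (hfg : Function.Exact f g) (hg : Function.Surjective g) [Module.Flat R Q] :
    IsPureInjective f := by
  intro N _ _
  have hπ : Function.Surjective (Finsupp.linearCombination R (id : N → N)) :=
    fun n => ⟨Finsupp.single n 1, by simp⟩
  exact rTensor_injective_of_flat hf hfg hg Subtype.val_injective
    (LinearMap.exact_subtype_ker_map _) hπ

/-- The common kernel of the maps `M ⊗ X → M ⊗ N i` induced by `φ i : X → N i` is zero. -/
def Detects {I : Type u} {X : Type u} [AddCommGroup X] [Module R X] {N : I → Type u}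
    [∀ i, AddCommGroup (N i)] [∀ i, Module R (N i)] (φ : ∀ i, X →ₗ[R] N i)
    (M : Type u) [AddCommGroup M] [Module R M] : Prop :=
  ∀ x : M ⊗[R] X, (∀ i, (φ i).lTensor M x = 0) → x = 0

section Detects

variable {I : Type u} {X : Type u} [AddCommGroup X] [Module R X] {N : I → Type u}
    [∀ i, AddCommGroup (N i)] [∀ i, Module R (N i)] {φ : ∀ i, X →ₗ[R] N i}

/-- Flatness and the Mittag-Leffler property are both instances of `Detects`, so their permanence
properties are proved once, for `Detects`. -/
theorem Detects.of_pure (hB : Detects φ B) {f : A →ₗ[R] B} (hf : IsPureInjective f) :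
    Detects φ A := by
  intro x hx
  apply hf X
  rw [map_zero]
  apply hB
  intro i
  rw [← LinearMap.comp_apply, LinearMap.lTensor_comp_rTensor, ← LinearMap.rTensor_comp_lTensor,
    LinearMap.comp_apply, hx i, map_zero]

theorem Detects.of_exact (hA : Detects φ A) (hQ : Detects φ Q) {f : A →ₗ[R] B} {g : B →ₗ[R] Q}
    (hf : IsPureInjective f) (hfg : Function.Exact f g) (hg : Function.Surjective g) :
    Detects φ B := by
  intro x hx
  have h1 : g.rTensor X x = 0 := by
    apply hQ
    intro i
    rw [← LinearMap.comp_apply, LinearMap.lTensor_comp_rTensor, ← LinearMap.rTensor_comp_lTensor,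
      LinearMap.comp_apply, hx i, map_zero]
  obtain ⟨a, rfl⟩ := (rTensor_exact X hfg hg _).1 h1
  rw [hA a, map_zero]
  intro i
  apply hf (N i)
  rw [map_zero, ← hx i, ← LinearMap.comp_apply, ← LinearMap.comp_apply,
    LinearMap.lTensor_comp_rTensor, LinearMap.rTensor_comp_lTensor]

end Detects

theorem flat_iff_detects {M : Type u} [AddCommGroup M] [Module R M] :
    Module.Flat R M ↔ ∀ J : Ideal R, Detects (I := PUnit) (fun _ => J.subtype) M := by
  rw [Module.Flat.iff_lTensor_injective']
  refine forall_congr' fun J => ?_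
  rw [injective_iff_map_eq_zero]
  exact forall_congr' fun x => ⟨fun h h' => h (h' ⟨⟩), fun h h' => h fun _ => h'⟩

theorem isMittagLeffler_iff_detects {M : Type u} [AddCommGroup M] [Module R M] :
    IsMittagLeffler R M ↔ ∀ (I : Type u) (N : I → Type u) [∀ i, AddCommGroup (N i)]
      [∀ i, Module R (N i)], Detects (fun i => (LinearMap.proj i : (∀ i, N i) →ₗ[R] N i)) M := by
  unfold IsMittagLeffler
  refine forall_congr' fun I => forall_congr' fun N => forall_congr' fun _ => forall_congr' fun _ =>
    ?_
  have key : ∀ (x : M ⊗[R] (∀ i, N i)) (i : I), TensorProduct.piRightHom R R M N x i =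
      (LinearMap.proj i : (∀ i, N i) →ₗ[R] N i).lTensor M x := by
    intro x i
    induction x with
    | zero => simp
    | tmul m n => simp
    | add x y hx hy => simp [hx, hy]
  rw [injective_iff_map_eq_zero]
  refine forall_congr' fun x => ?_
  rw [funext_iff]
  simp only [key, Pi.zero_apply]

/-- Flat and Mittag-Leffler. -/
def IsFlatML (R : Type u) [CommRing R] (M : Type u) [AddCommGroup M] [Module R M] : Prop :=
  Module.Flat R M ∧ IsMittagLeffler R M

theorem IsFlatML.of_pure (hB : IsFlatML R B) {f : A →ₗ[R] B} (hf : IsPureInjective f) :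
    IsFlatML R A := by
  refine ⟨flat_iff_detects.2 fun J => ((flat_iff_detects.1 hB.1) J).of_pure hf,
    isMittagLeffler_iff_detects.2 fun I N _ _ =>
      (isMittagLeffler_iff_detects.1 hB.2 I N).of_pure hf⟩

theorem IsFlatML.of_equiv (hB : IsFlatML R B) (e : A ≃ₗ[R] B) : IsFlatML R A :=
  hB.of_pure (IsPureInjective.of_leftInverse (f := e.toLinearMap) (g := e.symm.toLinearMap)
    (by ext; simp))

theorem IsFlatML.of_exact (hA : IsFlatML R A) (hQ : IsFlatML R Q) {f : A →ₗ[R] B} {g : B →ₗ[R] Q}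
    (hf : Function.Injective f) (hfg : Function.Exact f g) (hg : Function.Surjective g) :
    IsFlatML R B := by
  have := hQ.1
  have hf' := IsPureInjective.of_flat hf hfg hg
  exact ⟨flat_iff_detects.2 fun J => ((flat_iff_detects.1 hA.1) J).of_exact
      (flat_iff_detects.1 hQ.1 J) hf' hfg hg,
    isMittagLeffler_iff_detects.2 fun I N _ _ => (isMittagLeffler_iff_detects.1 hA.2 I N).of_exact
      (isMittagLeffler_iff_detects.1 hQ.2 I N) hf' hfg hg⟩

theorem isFlatML_of_subsingleton [Subsingleton A] : IsFlatML R A := by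
  refine ⟨inferInstance, fun I N _ _ => ?_⟩
  exact Function.injective_of_subsingleton _

theorem flat_of_pure [Module.Flat R B] {f : A →ₗ[R] B} (hf : IsPureInjective f) :
    Module.Flat R A :=
  flat_iff_detects.2 fun J => ((flat_iff_detects.1 ‹_›) J).of_pure hf

/-- An element of `Q ⊗ J` killed in `Q ⊗ R` lifts to `B ⊗ J`, with image in `B ⊗ R` coming from `A ⊗
R`. Purity tested on `R ⧸ J` moves that preimage into `A ⊗ J`, and flatness of `B` identifies it
with the lift. -/
theorem flat_quotient_of_pure [Module.Flat R B] {f : A →ₗ[R] B} {g : B →ₗ[R] Q}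
    (hf : IsPureInjective f) (hfg : Function.Exact f g) (hg : Function.Surjective g) :
    Module.Flat R Q := by
  rw [Module.Flat.iff_lTensor_injective']
  intro J
  have hJ : Function.Exact J.subtype J.mkQ := LinearMap.exact_subtype_mkQ J
  have hJ' : Function.Surjective J.mkQ := J.mkQ_surjective
  rw [injective_iff_map_eq_zero]
  intro x hx
  obtain ⟨b, rfl⟩ := LinearMap.rTensor_surjective J hg x
  have h1 : g.rTensor R (J.subtype.lTensor B b) = 0 := by
    rw [← hx, ← LinearMap.comp_apply, ← LinearMap.comp_apply, LinearMap.lTensor_comp_rTensor,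
      LinearMap.rTensor_comp_lTensor]
  obtain ⟨a, ha⟩ := (rTensor_exact R hfg hg _).1 h1
  have h2 : J.mkQ.lTensor A a = 0 := by
    apply hf
    rw [map_zero, ← LinearMap.comp_apply, LinearMap.rTensor_comp_lTensor,
      ← LinearMap.lTensor_comp_rTensor, LinearMap.comp_apply, ha]
    exact (lTensor_exact B hJ hJ' _).2 ⟨b, rfl⟩
  obtain ⟨a', rfl⟩ := (lTensor_exact A hJ hJ' _).1 h2
  have h3 : f.rTensor J a' = b := by
    apply Module.Flat.lTensor_preserves_injective_linearMap (M := B) J.subtype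
      Subtype.val_injective
    rw [← ha, ← LinearMap.comp_apply, ← LinearMap.comp_apply, LinearMap.lTensor_comp_rTensor,
      LinearMap.rTensor_comp_lTensor]
  rw [← h3]
  exact (rTensor_exact J hfg hg _).2 ⟨a', rfl⟩

end Purity

/-! ### Directed unions and continuous chains of pure submodules. -/

section Union

variable {R : Type u} [CommRing R] {M : Type u} [AddCommGroup M] [Module R M]
  {X : Type u} [AddCommGroup X] [Module R X]

theorem exists_le_of_fg_of_directed {ι : Type*} [Nonempty ι] {F : ι → Submodule R M}
    (hF : Directed (· ≤ ·) F) {Q : Submodule R M} (hQ : Q.FG) (hle : Q ≤ ⨆ i, F i) :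
    ∃ i, Q ≤ F i := by
  rw [Submodule.fg_iff_compact, CompleteLattice.isCompactElement_iff_le_of_directed_sSup_le] at hQ
  obtain ⟨_, ⟨i, rfl⟩, hi⟩ := hQ (Set.range F) (Set.range_nonempty F)
    (directedOn_range.2 hF) hle
  exact ⟨i, hi⟩

theorem exists_rTensor_inclusion_eq {ι : Type*} [Nonempty ι] {F : ι → Submodule R M}
    (hF : Directed (· ≤ ·) F) {P : Submodule R M} (hle : ∀ i, F i ≤ P) (hP : P ≤ ⨆ i, F i)
    (x : P ⊗[R] X) : ∃ i, ∃ y : F i ⊗[R] X, (Submodule.inclusion (hle i)).rTensor X y = x := by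
  induction x with
  | zero => exact ⟨Classical.arbitrary ι, 0, map_zero _⟩
  | tmul p x =>
    obtain ⟨i, hi⟩ := (Submodule.mem_iSup_of_directed F hF).1 (hP p.2)
    exact ⟨i, (⟨p, hi⟩ : F i) ⊗ₜ x, rfl⟩
  | add x y hx hy =>
    obtain ⟨i, x, rfl⟩ := hx
    obtain ⟨j, y, rfl⟩ := hy
    obtain ⟨k, hik, hjk⟩ := hF i j
    refine ⟨k, (Submodule.inclusion hik).rTensor X x + (Submodule.inclusion hjk).rTensor X y, ?_⟩
    rw [map_add, ← LinearMap.comp_apply, ← LinearMap.comp_apply, ← LinearMap.rTensor_comp,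
      ← LinearMap.rTensor_comp]
    rfl

/-- A tensor vanishes because of finitely many relations, which live in a finitely generated
submodule of the union and hence already in one member. -/
theorem exists_rTensor_inclusion_eq_zero {ι : Type*} [Nonempty ι] {F : ι → Submodule R M}
    (hF : Directed (· ≤ ·) F) {P : Submodule R M} (hle : ∀ i, F i ≤ P) (hP : P ≤ ⨆ i, F i)
    {i : ι} (y : F i ⊗[R] X) (hy : (Submodule.inclusion (hle i)).rTensor X y = 0) :
    ∃ j, ∃ h : F i ≤ F j, (Submodule.inclusion h).rTensor X y = 0 := by
  obtain ⟨P₁, hP₁, t, rfl⟩ := TensorProduct.exists_of_fg y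
  let ι₁ : P₁ →ₗ[R] P₁.map (Submodule.inclusion (hle i)) :=
    (Submodule.inclusion (hle i)).submoduleMap P₁
  have h1 : (P₁.map (Submodule.inclusion (hle i))).subtype.rTensor X (ι₁.rTensor X t) = 0 := by
    rw [← hy, ← LinearMap.comp_apply, ← LinearMap.comp_apply, ← LinearMap.rTensor_comp,
      ← LinearMap.rTensor_comp]
    rfl
  obtain ⟨Q, hPQ, hQ, h2⟩ := TensorProduct.eq_zero_of_fg_of_subtype_eq_zero (hP₁.map _) h1
  obtain ⟨j, hj⟩ := exists_le_of_fg_of_directed hF (hQ.map P.subtype)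
    ((Submodule.map_subtype_le P Q).trans hP)
  obtain ⟨k, hik, hjk⟩ := hF i j
  refine ⟨k, hik, ?_⟩
  let q : Q →ₗ[R] F k := (P.subtype ∘ₗ Q.subtype).codRestrict (F k)
    fun x => hjk (hj (Submodule.mem_map_of_mem x.2))
  have h3 := congrArg (q.rTensor X) h2
  rw [map_zero] at h3
  rw [← h3, ← LinearMap.comp_apply, ← LinearMap.comp_apply, ← LinearMap.comp_apply,
    ← LinearMap.rTensor_comp, ← LinearMap.rTensor_comp, ← LinearMap.rTensor_comp]
  rfl

theorem isPureInjective_inclusion_of_directed {ι : Type*} [Nonempty ι] {F : ι → Submodule R M}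
    (hF : Directed (· ≤ ·) F) {P : Submodule R M} (hle : ∀ i, F i ≤ P) (hP : P ≤ ⨆ i, F i)
    (h : ∀ i j, ∀ hij : F i ≤ F j, IsPureInjective (Submodule.inclusion hij)) (i : ι) :
    IsPureInjective (Submodule.inclusion (hle i)) := by
  intro N _ _
  rw [injective_iff_map_eq_zero]
  intro y hy
  obtain ⟨j, hij, hj⟩ := exists_rTensor_inclusion_eq_zero hF hle hP y hy
  exact h i j hij N (by rw [hj, map_zero])

theorem isPureInjective_subtype_of_directed {ι : Type*} [Nonempty ι] {F : ι → Submodule R M}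
    (hF : Directed (· ≤ ·) F) {P : Submodule R M} (hle : ∀ i, F i ≤ P) (hP : P ≤ ⨆ i, F i)
    (h : ∀ i, IsPureInjective (F i).subtype) : IsPureInjective P.subtype := by
  intro N _ _
  rw [injective_iff_map_eq_zero]
  intro x hx
  obtain ⟨i, y, rfl⟩ := exists_rTensor_inclusion_eq hF hle hP x
  rw [← LinearMap.comp_apply, ← LinearMap.rTensor_comp, Submodule.subtype_comp_inclusion] at hx
  rw [(injective_iff_map_eq_zero _).1 (h i N) y hx, map_zero]

theorem Detects.of_directed {I : Type u} {N : I → Type u}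
    [∀ i, AddCommGroup (N i)] [∀ i, Module R (N i)] {φ : ∀ i, X →ₗ[R] N i}
    {ι : Type*} [Nonempty ι] {F : ι → Submodule R M}
    (hF : Directed (· ≤ ·) F) {P : Submodule R M} (hle : ∀ i, F i ≤ P) (hP : P ≤ ⨆ i, F i)
    (hpure : ∀ i, IsPureInjective (Submodule.inclusion (hle i))) (h : ∀ i, Detects φ (F i)) :
    Detects φ P := by
  intro x hx
  obtain ⟨i, y, rfl⟩ := exists_rTensor_inclusion_eq hF hle hP x
  rw [h i y, map_zero]
  intro j
  apply hpure i (N j)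
  rw [map_zero, ← hx j, ← LinearMap.comp_apply, ← LinearMap.comp_apply,
    LinearMap.lTensor_comp_rTensor, LinearMap.rTensor_comp_lTensor]

theorem IsFlatML.of_directed {ι : Type*} [Nonempty ι] {F : ι → Submodule R M}
    (hF : Directed (· ≤ ·) F) {P : Submodule R M} (hle : ∀ i, F i ≤ P) (hP : P ≤ ⨆ i, F i)
    (hpure : ∀ i, IsPureInjective (Submodule.inclusion (hle i))) (h : ∀ i, IsFlatML R (F i)) :
    IsFlatML R P :=
  ⟨flat_iff_detects.2 fun J => Detects.of_directed hF hle hP hpure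
      fun i => flat_iff_detects.1 (h i).1 J,
    isMittagLeffler_iff_detects.2 fun I N _ _ => Detects.of_directed hF hle hP hpure
      fun i => isMittagLeffler_iff_detects.1 (h i).2 I N⟩

theorem isPureInjective_inclusion_refl {P : Submodule R M} (h : P ≤ P) :
    IsPureInjective (Submodule.inclusion h) :=
  IsPureInjective.of_leftInverse (g := LinearMap.id) rfl

theorem isPureInjective_inclusion_trans {P P' P'' : Submodule R M} {h : P ≤ P'} {h' : P' ≤ P''}
    (hp' : IsPureInjective (Submodule.inclusion h'))
    (hp : IsPureInjective (Submodule.inclusion h)) :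
    IsPureInjective (Submodule.inclusion (h.trans h')) := by
  have e : Submodule.inclusion (h.trans h') = Submodule.inclusion h' ∘ₗ Submodule.inclusion h := by
    ext; rfl
  rw [e]
  exact hp'.comp hp

theorem exact_inclusion_mkQ {P Q : Submodule R M} (h : P ≤ Q) :
    Function.Exact (Submodule.inclusion h) (P.submoduleOf Q).mkQ := by
  intro x
  refine (Submodule.Quotient.mk_eq_zero _).trans ?_
  exact ⟨fun hx => ⟨⟨x, hx⟩, rfl⟩, by rintro ⟨y, rfl⟩; exact y.2⟩

/-- A continuous chain of submodules indexed by the ordinals `≤ σ`, starting at zero. -/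
structure IsContinuousChain (σ : Ordinal.{u}) (F : Ordinal.{u} → Submodule R M) : Prop where
  mono : MonotoneOn F (Set.Iic σ)
  zero : F 0 = ⊥
  limit : ∀ β ≤ σ, Order.IsSuccLimit β → F β = ⨆ α : Set.Iio β, F α

namespace IsContinuousChain

variable {σ : Ordinal.{u}} {F : Ordinal.{u} → Submodule R M}

theorem le (h : IsContinuousChain σ F) {α β : Ordinal.{u}} (hαβ : α ≤ β) (hβ : β ≤ σ) :
    F α ≤ F β :=
  h.mono (hαβ.trans hβ) hβ hαβ

theorem directed (h : IsContinuousChain σ F) {β : Ordinal.{u}} (hβ : β ≤ σ) :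
    Directed (· ≤ ·) fun α : Set.Iio β => F α := by
  intro a b
  rcases le_total a.1 b.1 with hab | hab
  · exact ⟨b, h.le hab (b.2.le.trans hβ), le_rfl⟩
  · exact ⟨a, le_rfl, h.le hab (a.2.le.trans hβ)⟩

/-- Purity of the inclusions is carried through the induction because at limits `Detects` passes to
the union only along pure inclusions. -/
theorem isFlatML_and_pure (h : IsContinuousChain σ F)
    (hfac : ∀ α < σ, IsFlatML R (F (Order.succ α) ⧸ (F α).submoduleOf (F (Order.succ α))))
    (β : Ordinal.{u}) (hβ : β ≤ σ) : IsFlatML R (F β) ∧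
      ∀ α, ∀ hαβ : α ≤ β, IsPureInjective (Submodule.inclusion (h.le hαβ hβ)) := by
  induction β using SuccOrder.limitRecOn with
  | isMin β hmin =>
    obtain rfl : β = 0 := hmin.eq_bot
    have : Subsingleton (F 0) := by rw [h.zero]; infer_instance
    refine ⟨isFlatML_of_subsingleton, fun α hα => ?_⟩
    have hα0 : α = 0 := by simpa using hα
    subst hα0
    exact isPureInjective_inclusion_refl _
  | succ β _ ih =>
    have hβσ : β < σ := (Order.lt_succ β).trans_le hβ
    obtain ⟨ih1, ih2⟩ := ih hβσ.le
    have hle := h.le (Order.le_succ β) hβ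
    have hex := exact_inclusion_mkQ hle
    have hsurj := ((F β).submoduleOf (F (Order.succ β))).mkQ_surjective
    have hflat := (hfac β hβσ).1
    refine ⟨ih1.of_exact (hfac β hβσ) (Submodule.inclusion_injective hle) hex hsurj,
      fun α hα => ?_⟩
    rcases Order.le_succ_iff_eq_or_le.1 hα with rfl | hα'
    · exact isPureInjective_inclusion_refl _
    · exact isPureInjective_inclusion_trans
        (IsPureInjective.of_flat (Submodule.inclusion_injective hle) hex hsurj) (ih2 α hα')
  | isSuccLimit β hlim ih =>
    have : Nonempty (Set.Iio β) := ⟨⟨0, hlim.bot_lt⟩⟩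
    have hdir := h.directed hβ
    have hle : ∀ α : Set.Iio β, F α ≤ F β := fun α => h.le α.2.le hβ
    have hsup := (h.limit β hβ hlim).le
    have hpure : ∀ α : Set.Iio β, IsPureInjective (Submodule.inclusion (hle α)) := by
      refine isPureInjective_inclusion_of_directed hdir hle hsup fun α γ hαγ => ?_
      rcases le_total α.1 γ.1 with hle' | hle'
      · exact (ih γ.1 γ.2 (γ.2.le.trans hβ)).2 α.1 hle'
      · exact IsPureInjective.of_leftInverse
          (g := Submodule.inclusion (h.le hle' (α.2.le.trans hβ))) rfl
    refine ⟨IsFlatML.of_directed hdir hle hsup hpure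
      fun α => (ih α.1 α.2 (α.2.le.trans hβ)).1, fun α hα => ?_⟩
    rcases hα.lt_or_eq with hlt | rfl
    · exact hpure ⟨α, hlt⟩
    · exact isPureInjective_inclusion_refl _

/-- A module filtered by flat Mittag-Leffler modules is flat Mittag-Leffler. -/
theorem isFlatML (h : IsContinuousChain σ F) (htop : F σ = ⊤)
    (hfac : ∀ α < σ, IsFlatML R (F (Order.succ α) ⧸ (F α).submoduleOf (F (Order.succ α)))) :
    IsFlatML R M := by
  have := (h.isFlatML_and_pure hfac σ le_rfl).1
  rw [htop] at this
  exact this.of_equiv Submodule.topEquiv.symm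

end IsContinuousChain

end Union

/-! ### Finite tuples in a flat Mittag-Leffler module and their most economical factorizations. -/

section Tuples

variable {R : Type u} [CommRing R] {Q : Type u} [AddCommGroup Q] [Module R Q]

/-- Every finite tuple `x` in a flat Mittag-Leffler module has a factorization `x = A y` such that
`A` factors through every other factorization of `x`. -/
theorem IsFlatML.exists_dominating (hQ : IsFlatML R Q) {n : ℕ} (x : Fin n → Q) :
    ∃ (m : ℕ) (A : Matrix (Fin n) (Fin m) R) (y : Fin m → Q), (∀ i, x i = ∑ j, A i j • y j) ∧
      ∀ (l : ℕ) (B : Matrix (Fin n) (Fin l) R) (w : Fin l → Q), (∀ i, x i = ∑ j, B i j • w j) →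
        ∃ G : Matrix (Fin l) (Fin m) R, A = B * G := by
  classical
  have := hQ.1
  -- The Mittag-Leffler property is tested on the cokernels of all matrices `B` through which `x`
  -- factors. The tensor `∑ x i ⊗ e i` dies in each `Q ⊗ coker B`, hence in `Q ⊗ ∏ coker B`.
  let I : Type u := {p : Σ l : ℕ, Matrix (Fin n) (Fin l) R //
    ∃ w : Fin p.1 → Q, ∀ i, x i = ∑ j, p.2 i j • w j}
  let N : I → Type u := fun p => (Fin n → R) ⧸ LinearMap.range p.1.2.mulVecLin
  let e : Fin n → ∀ p, N p := fun i p => Submodule.Quotient.mk (Pi.single i 1)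
  have hsum : ∀ (p : I) (c : Fin n → R), ∑ i, c i • e i p = Submodule.Quotient.mk c := by
    intro p c
    have : c = ∑ i, c i • (Pi.single i 1 : Fin n → R) := by
      rw [← Finset.univ_sum_single c]
      refine Finset.sum_congr rfl fun i _ => ?_
      ext j
      rw [Finset.univ_sum_single c]
      by_cases h : j = i
      · subst h; simp
      · simp [h]
    conv_rhs => rw [this]
    simp only [e, ← Submodule.mkQ_apply, map_sum, map_smul]
  have hzero : ∑ i, x i ⊗ₜ[R] e i = 0 := by
    apply isMittagLeffler_iff_detects.1 hQ.2 I N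
    intro p
    obtain ⟨w, hw⟩ := p.2
    simp only [map_sum, LinearMap.lTensor_tmul, LinearMap.proj_apply]
    simp_rw [hw, TensorProduct.sum_tmul, TensorProduct.smul_tmul]
    rw [Finset.sum_comm]
    refine Finset.sum_eq_zero fun j _ => ?_
    rw [← TensorProduct.tmul_sum, hsum p fun i => p.1.2 i j]
    have : (fun i => p.1.2 i j) ∈ LinearMap.range p.1.2.mulVecLin :=
      ⟨Pi.single j 1, by ext i; simp⟩
    rw [(Submodule.Quotient.mk_eq_zero _).2 this, TensorProduct.tmul_zero]
  have hzero' : ∑ i, e i ⊗ₜ[R] x i = 0 := by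
    have := congrArg (TensorProduct.comm R _ _) hzero
    simpa using this
  -- The equational criterion for vanishing gives `x = A y` with every column of `A` zero in every
  -- `coker B`, that is, in the range of `B`.
  obtain ⟨m, A, y, hx, hA⟩ :=
    TensorProduct.vanishesTrivially_of_sum_tmul_eq_zero_of_rTensor_injective R
      (Module.Flat.rTensor_preserves_injective_linearMap (M := Q) _ Subtype.val_injective) hzero'
  refine ⟨m, A, y, hx, fun l B w hB => ?_⟩
  have hcol : ∀ j, ∃ c : Fin l → R, B.mulVec c = fun i => A i j := by
    intro j
    have h1 := congrFun (hA j) ⟨⟨l, B⟩, w, hB⟩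
    rw [Finset.sum_apply] at h1
    simp only [Pi.smul_apply, Pi.zero_apply] at h1
    rw [hsum ⟨⟨l, B⟩, w, hB⟩ fun i => A i j] at h1
    exact (Submodule.Quotient.mk_eq_zero _).1 h1
  choose c hc using hcol
  refine ⟨Matrix.of fun k j => c j k, ?_⟩
  ext i j
  rw [Matrix.mul_apply]
  exact (congrFun (hc j) i).symm

/-- By flatness a relation `k` on `x` comes from a factorization `x = B w` with `k B = 0`, and `A`
factors through `B`. -/
theorem IsFlatML.sum_mul_eq_zero (hQ : IsFlatML R Q) {n m : ℕ} {x : Fin n → Q}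
    {A : Matrix (Fin n) (Fin m) R} (hA : ∀ (l : ℕ) (B : Matrix (Fin n) (Fin l) R) (w : Fin l → Q),
      (∀ i, x i = ∑ j, B i j • w j) → ∃ G : Matrix (Fin l) (Fin m) R, A = B * G)
    {k : Fin n → R} (hk : ∑ i, k i • x i = 0) (j : Fin m) : ∑ i, k i * A i j = 0 := by
  have := hQ.1
  obtain ⟨l, B, w, hx, hB⟩ := Module.Flat.isTrivialRelation_of_sum_smul_eq_zero hk
  obtain ⟨G, rfl⟩ := hA l (Matrix.of B) w hx
  simp only [Matrix.mul_apply, Matrix.of_apply, Finset.mul_sum]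
  rw [Finset.sum_comm]
  refine Finset.sum_eq_zero fun a _ => ?_
  simp only [← mul_assoc, ← Finset.sum_mul]
  rw [hB a, zero_mul]

/-- If a free module maps onto a flat Mittag-Leffler module, then on any finite set of basis
vectors the projection is realized by an endomorphism which kills all the relations. -/
theorem IsFlatML.exists_endomorphism (hQ : IsFlatML R Q) {X : Type u} {π : (X →₀ R) →ₗ[R] Q}
    (hπ : Function.Surjective π) (s : Finset X) :
    ∃ φ : (X →₀ R) →ₗ[R] (X →₀ R), (∀ y ∈ s, π (φ (Finsupp.single y 1)) = π (Finsupp.single y 1)) ∧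
      ∀ k ∈ Finsupp.supported R R (s : Set X), π k = 0 → φ k = 0 := by
  classical
  let e : Fin s.card ≃ s := s.equivFin.symm
  obtain ⟨m, A, y, hx, hA⟩ := hQ.exists_dominating fun i => π (Finsupp.single (e i : X) 1)
  choose z hz using fun j => hπ (y j)
  -- With `x = A y` dominating and `z` lifting `y`, the basis vectors in `s` go to `A z` and all
  -- others to `0`.
  let φ : (X →₀ R) →ₗ[R] (X →₀ R) := Finsupp.linearCombination R fun x =>
    if h : x ∈ s then ∑ j, A (e.symm ⟨x, h⟩) j • z j else 0
  have hφ : ∀ i, φ (Finsupp.single (e i : X) 1) = ∑ j, A i j • z j := by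
    intro i
    simp [φ]
  refine ⟨φ, fun y hy => ?_, fun k hk hk0 => ?_⟩
  · obtain ⟨i, hi⟩ := e.surjective ⟨y, hy⟩
    obtain rfl : (e i : X) = y := by rw [hi]
    rw [hφ, hx]
    simp [hz]
  · have hsum : k = ∑ i, k (e i) • Finsupp.single (e i : X) 1 := by
      rw [e.sum_comp fun x : s => k x • Finsupp.single (x : X) (1 : R),
        Finset.sum_coe_sort s fun x => k x • Finsupp.single (x : X) (1 : R)]
      conv_lhs => rw [← Finsupp.sum_single k]
      rw [Finsupp.sum_of_support_subset k (s := s) (by exact_mod_cast hk) _ (by simp)]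
      simp
    rw [hsum] at hk0 ⊢
    simp only [map_sum, map_smul] at hk0 ⊢
    simp_rw [hφ, Finset.smul_sum, smul_smul]
    rw [Finset.sum_comm]
    refine Finset.sum_eq_zero fun j _ => ?_
    rw [← Finset.sum_smul, hQ.sum_mul_eq_zero hA hk0, zero_smul]

end Tuples

/-! ### From `κ` generators to `κ` relations. -/

section Presentation

variable {R : Type u} [CommRing R] {Q : Type u} [AddCommGroup Q] [Module R Q]

theorem mk_finset_le {κ : Cardinal.{u}} (hκ : ℵ₀ ≤ κ) {X : Type u} (hX : #X ≤ κ) :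
    #(Finset X) ≤ κ := by
  cases finite_or_infinite X
  · exact (Cardinal.mk_lt_aleph0_iff.2 inferInstance).le.trans hκ
  · rwa [Cardinal.mk_finset_of_infinite]

theorem eq_of_mem_supported {X : Type u} {Q : Type u} [AddCommGroup Q] [Module R Q]
    {f g : (X →₀ R) →ₗ[R] Q} {s : Set X}
    (h : ∀ y ∈ s, f (Finsupp.single y 1) = g (Finsupp.single y 1))
    {k : X →₀ R} (hk : k ∈ Finsupp.supported R R s) : f k = g k := by
  rw [Finsupp.supported_eq_span_single] at hk
  refine LinearMap.eqOn_span (s := (fun i => Finsupp.single i (1 : R)) '' s) ?_ hk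
  rintro _ ⟨y, hy, rfl⟩
  exact h y hy

/-- A flat Mittag-Leffler module with `≤ κ` generators is `≤ κ`-presented. -/
theorem IsFlatML.isLEPresented (hQ : IsFlatML R Q) {κ : Cardinal.{u}} (hκ : ℵ₀ ≤ κ) {X : Type u}
    (hX : #X ≤ κ) {π : (X →₀ R) →ₗ[R] Q} (hπ : Function.Surjective π) : IsLEPresented R κ Q := by
  classical
  choose φ hφ hφ' using fun s => hQ.exists_endomorphism hπ s
  -- These relations suffice: if `π k = 0` and `s` is the support of `k`, then `φ s k = 0`, so `k =
  -- k - φ s k` is a combination of the vectors `y - φ s y` with `y ∈ s`.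
  let r : Finset X × X → (X →₀ R) := fun p =>
    if p.2 ∈ p.1 then Finsupp.single p.2 1 - φ p.1 (Finsupp.single p.2 1) else 0
  refine ⟨X, Finset X × X, Finsupp.linearCombination R r, π, hX, ?_, ?_, hπ⟩
  · rw [Cardinal.mk_prod, Cardinal.lift_id, Cardinal.lift_id]
    exact Cardinal.mul_le_of_le hκ (mk_finset_le hκ hX) hX
  · have hr : ∀ p, π (r p) = 0 := by
      intro p
      by_cases hp : p.2 ∈ p.1
      · simp [r, hp, hφ _ _ hp]
      · simp [r, hp]
    intro k
    constructor
    · intro hk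
      have hks : k ∈ Finsupp.supported R R (k.support : Set X) := by
        simp [Finsupp.mem_supported]
      have h0 := hφ' k.support k hks hk
      let ψ : (X →₀ R) →ₗ[R] (X →₀ R) := LinearMap.id - φ k.support
      have h1 : ψ k ∈
          LinearMap.range (Finsupp.linearCombination R r) := by
        rw [Finsupp.range_linearCombination]
        rw [Finsupp.supported_eq_span_single] at hks
        refine Submodule.span_induction (p := fun k _ => ψ k ∈ _) ?_ ?_ ?_ ?_ hks
        · rintro _ ⟨y, hy, rfl⟩
          refine Submodule.subset_span ⟨(k.support, y), ?_⟩
          have : y ∈ k.support := hy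
          simp only [r, if_pos this]
          rfl
        · simp
        · intro a b _ _ ha hb
          rw [map_add]
          exact add_mem ha hb
        · intro c a _ ha
          rw [map_smul]
          exact Submodule.smul_mem _ c ha
      simpa [ψ, h0] using h1
    · rintro ⟨c, rfl⟩
      have : π ∘ₗ Finsupp.linearCombination R r = 0 := by
        ext p
        simp [hr]
      exact LinearMap.congr_fun this c

end Presentation

/-! ### Countably generated flat Mittag-Leffler modules are projective. -/

section Countable

variable {R : Type u} [CommRing R] {Q : Type u} [AddCommGroup Q] [Module R Q]

/-- A zero column makes room for a prescribed entry `q`, so that a sequence of successive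
factorizations can be made to pass through all generators. -/
theorem IsFlatML.exists_dominating_cons (hQ : IsFlatML R Q) {n : ℕ} (x : Fin n → Q) (q : Q) :
    ∃ (m : ℕ) (A : Matrix (Fin n) (Fin m) R) (y : Fin m → Q), (∀ i, x i = ∑ j, A i j • y j) ∧
      (∃ j, y j = q) ∧
      ∀ (l : ℕ) (B : Matrix (Fin n) (Fin l) R) (w : Fin l → Q), (∀ i, x i = ∑ j, B i j • w j) →
        ∃ G : Matrix (Fin l) (Fin m) R, A = B * G := by
  obtain ⟨m, A, y, hx, hA⟩ := hQ.exists_dominating x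
  refine ⟨m + 1, Matrix.of fun i => Fin.cons 0 (A i), Fin.cons q y, fun i => ?_, ⟨0, rfl⟩,
    fun l B w hB => ?_⟩
  · simp [Fin.sum_univ_succ, hx]
  · obtain ⟨G, hG⟩ := hA l B w hB
    refine ⟨Matrix.of fun i => Fin.cons 0 (G i), ?_⟩
    ext i j
    refine Fin.cases ?_ (fun j => ?_) j
    · simp [Matrix.mul_apply]
    · simp [Matrix.mul_apply, hG]

/-- The action of a matrix on tuples of elements of a module. -/
def tupleSMul {n m : ℕ} (B : Matrix (Fin n) (Fin m) R) (v : Fin m → Q) : Fin n → Q :=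
  fun i => ∑ j, B i j • v j

theorem tupleSMul_mul {n m l : ℕ} (B : Matrix (Fin n) (Fin m) R) (C : Matrix (Fin m) (Fin l) R)
    (v : Fin l → Q) : tupleSMul (B * C) v = tupleSMul B (tupleSMul C v) := by
  ext i
  simp only [tupleSMul, Matrix.mul_apply, Finset.sum_smul, Finset.smul_sum, smul_smul]
  rw [Finset.sum_comm]

theorem tupleSMul_add {n m : ℕ} (B : Matrix (Fin n) (Fin m) R) (v w : Fin m → Q) :
    tupleSMul B (v + w) = tupleSMul B v + tupleSMul B w := by
  ext i
  simp [tupleSMul, Finset.sum_add_distrib]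

theorem tupleSMul_sub {n m : ℕ} (B : Matrix (Fin n) (Fin m) R) (v w : Fin m → Q) :
    tupleSMul B (v - w) = tupleSMul B v - tupleSMul B w := by
  ext i
  simp [tupleSMul, smul_sub]

theorem map_tupleSMul {E : Type u} [AddCommGroup E] [Module R E] (π : E →ₗ[R] Q) {n m : ℕ}
    (B : Matrix (Fin n) (Fin m) R) (v : Fin m → E) : π ∘ tupleSMul B v = tupleSMul B (π ∘ v) := by
  ext i
  simp [tupleSMul]

/-- A countably generated flat Mittag-Leffler module is projective. -/
theorem IsFlatML.projective_of_countable (hQ : IsFlatML R Q) (e : ℕ → Q)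
    (he : Submodule.span R (Set.range e) = ⊤) : Module.Projective R Q := by
  choose m M y hx hq hM using fun (n : ℕ) (x : Fin n → Q) (q : Q) => hQ.exists_dominating_cons x q
  let st : ℕ → Σ n : ℕ, (Fin n → Q) := fun k =>
    Nat.rec ⟨0, Fin.elim0⟩ (fun k s => ⟨m s.1 s.2 (e k), y s.1 s.2 (e k)⟩) k
  let n : ℕ → ℕ := fun k => (st k).1
  let x : ∀ k, Fin (n k) → Q := fun k => (st k).2
  let A : ∀ k, Matrix (Fin (n k)) (Fin (n (k + 1))) R := fun k => M (n k) (x k) (e k)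
  have hxA : ∀ k, x k = tupleSMul (A k) (x (k + 1)) := fun k => funext (hx (n k) (x k) (e k))
  have hxe : ∀ k, ∃ j, x (k + 1) j = e k := fun k => hq (n k) (x k) (e k)
  have hA : ∀ k l (B : Matrix (Fin (n k)) (Fin l) R) (w : Fin l → Q), x k = tupleSMul B w →
      ∃ G : Matrix (Fin l) (Fin (n (k + 1))) R, A k = B * G :=
    fun k l B w h => hM (n k) (x k) (e k) l B w (congrFun h)
  clear_value A x n
  clear st hx hq hM
  let π : (Q →₀ R) →ₗ[R] Q := Finsupp.linearCombination R id
  have hπ : Function.Surjective π := fun q => ⟨Finsupp.single q 1, by simp [π]⟩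
  have hlift : ∀ k, ∃ t : Fin (n k) → (Q →₀ R), π ∘ t = x k := by
    intro k
    choose t ht using fun i => hπ (x k i)
    exact ⟨t, funext ht⟩
  -- Lifts of consecutive tuples can be made compatible after applying `A k`: since `A k = A k * A
  -- (k + 1) * G`, the discrepancy `δ`, which lies over `0`, is absorbed by adding `G δ` to the new
  -- lift.
  have hnext : ∀ k (t : {t : Fin (n (k + 1)) → (Q →₀ R) // π ∘ t = x (k + 1)}),
      ∃ t' : {t : Fin (n (k + 1 + 1)) → (Q →₀ R) // π ∘ t = x (k + 1 + 1)},
        tupleSMul (A k) t.1 = tupleSMul (A k) (tupleSMul (A (k + 1)) t'.1) := by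
    rintro k ⟨t, ht⟩
    obtain ⟨t', ht'⟩ := hlift (k + 1 + 1)
    obtain ⟨G, hG⟩ := hA k _ (A k * A (k + 1)) (x (k + 1 + 1))
      (by rw [tupleSMul_mul, ← hxA, ← hxA])
    let δ := t - tupleSMul (A (k + 1)) t'
    have hδ : π ∘ δ = 0 := by
      have h1 := map_tupleSMul π (A (k + 1)) t'
      rw [ht', ← hxA, ← ht] at h1
      ext i
      have := congrFun h1 i
      simp only [Function.comp_apply] at this
      simp [δ, this]
    refine ⟨⟨t' + tupleSMul G δ, ?_⟩, ?_⟩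
    · have h2 := map_tupleSMul π G δ
      rw [hδ] at h2
      ext i
      have h3 := congrFun h2 i
      have h4 := congrFun ht' i
      simp only [Function.comp_apply] at h3 h4
      rw [Function.comp_apply, Pi.add_apply, map_add, h4, h3]
      simp [tupleSMul]
    · simp only
      rw [← tupleSMul_mul, tupleSMul_add, ← tupleSMul_mul (A k * A (k + 1)), ← hG, tupleSMul_sub,
        tupleSMul_mul]
      abel
  choose next hnext using hnext
  let T : ∀ k, {t : Fin (n (k + 1)) → (Q →₀ R) // π ∘ t = x (k + 1)} := fun k =>
    Nat.rec ⟨(hlift 1).choose, (hlift 1).choose_spec⟩ (fun k t => next k t) k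
  have hT : ∀ k, tupleSMul (A k) (T k).1 =
      tupleSMul (A k) (tupleSMul (A (k + 1)) (T (k + 1)).1) := fun k => hnext k (T k)
  clear_value T
  let s : ∀ k, Fin (n k) → (Q →₀ R) := fun k => tupleSMul (A k) (T k).1
  have hs : ∀ k, s k = tupleSMul (A k) (s (k + 1)) := hT
  have hπs : ∀ k, π ∘ s k = x k := fun k => by
    rw [map_tupleSMul, (T k).2, ← hxA]
  -- The section of `π` is built as a graph, spanned by the pairs `(x k i, s k i)`. It is
  -- single-valued because a relation `c` on `x k` satisfies `c A k = 0`, while `s k` is `A k`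
  -- applied to a lift.
  let Γ : ℕ → Submodule R (Q × (Q →₀ R)) := fun k =>
    Submodule.span R (Set.range fun i => (x k i, s k i))
  have hΓ : Monotone Γ := by
    refine monotone_nat_of_le_succ fun k => ?_
    rw [Submodule.span_le]
    rintro _ ⟨i, rfl⟩
    have : (x k i, s k i) = ∑ j, A k i j • (x (k + 1) j, s (k + 1) j) := by
      refine Prod.ext ?_ ?_
      · rw [Prod.fst_sum]; exact congrFun (hxA k) i
      · rw [Prod.snd_sum]; exact congrFun (hs k) i
    rw [SetLike.mem_coe]
    simp only [this]
    exact Submodule.sum_mem _ fun j _ => Submodule.smul_mem _ _ (Submodule.subset_span ⟨j, rfl⟩)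
  let p : (⨆ k, Γ k : Submodule R (Q × (Q →₀ R))) →ₗ[R] Q :=
    LinearMap.fst R Q (Q →₀ R) ∘ₗ Submodule.subtype _
  have hpinj : Function.Injective p := by
    rw [injective_iff_map_eq_zero]
    rintro ⟨⟨q, f⟩, hg⟩ (hg0 : q = 0)
    subst hg0
    obtain ⟨k, hk⟩ := (Submodule.mem_iSup_of_directed Γ hΓ.directed_le).1 hg
    obtain ⟨c, hc⟩ := (Submodule.mem_span_range_iff_exists_fun R).1 hk
    have h1 : ∑ i, c i • x k i = 0 := by
      have := congrArg Prod.fst hc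
      rwa [Prod.fst_sum] at this
    have h2 : ∑ i, c i • s k i = f := by
      have := congrArg Prod.snd hc
      rwa [Prod.snd_sum] at this
    have h3 : f = 0 := by
      rw [← h2]
      simp only [s, tupleSMul, Finset.smul_sum, smul_smul]
      rw [Finset.sum_comm]
      refine Finset.sum_eq_zero fun j _ => ?_
      rw [← Finset.sum_smul, hQ.sum_mul_eq_zero (x := x k)
        (fun l B w h => hA k l B w (funext h)) h1, zero_smul]
    subst h3
    rfl
  have hpsurj : Function.Surjective p := by
    rw [← LinearMap.range_eq_top, ← top_le_iff, ← he, Submodule.span_le]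
    rintro _ ⟨k, rfl⟩
    obtain ⟨j, hj⟩ := hxe k
    refine ⟨⟨(x (k + 1) j, s (k + 1) j), ?_⟩, hj⟩
    exact Submodule.mem_iSup_of_mem (k + 1) (Submodule.subset_span ⟨j, rfl⟩)
  have hgraph : ∀ g : (⨆ k, Γ k : Submodule R (Q × (Q →₀ R))), π g.1.2 = g.1.1 := by
    rintro ⟨g, hg⟩
    have : (⨆ k, Γ k) ≤ LinearMap.eqLocus (π ∘ₗ LinearMap.snd R Q (Q →₀ R))
        (LinearMap.fst R Q (Q →₀ R)) := by
      refine iSup_le fun k => ?_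
      rw [Submodule.span_le]
      rintro _ ⟨i, rfl⟩
      exact congrFun (hπs k) i
    exact this hg
  let ε := LinearEquiv.ofBijective p ⟨hpinj, hpsurj⟩
  rw [Module.projective_def']
  refine ⟨LinearMap.snd R Q (Q →₀ R) ∘ₗ Submodule.subtype _ ∘ₗ ε.symm.toLinearMap, ?_⟩
  ext q
  have h1 := hgraph (ε.symm q)
  have h2 : (ε.symm q).1.1 = q := ε.apply_symm_apply q
  rw [h2] at h1
  exact h1

theorem IsFlatML.projective_of_isLEPresented (hQ : IsFlatML R Q) (h : IsLEPresented R ℵ₀ Q) :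
    Module.Projective R Q := by
  obtain ⟨I, J, f, g, hI, -, -, hg⟩ := h
  have : Countable I := Cardinal.mk_le_aleph0_iff.1 hI
  have := Encodable.ofCountable I
  refine hQ.projective_of_countable
    (fun k => ((Encodable.decode k : Option I).map fun i => g (Finsupp.single i 1)).getD 0) ?_
  rw [eq_top_iff]
  rintro q -
  obtain ⟨f, rfl⟩ := hg q
  induction f using Finsupp.induction_linear with
  | zero => simp
  | add f₁ f₂ h₁ h₂ => rw [map_add]; exact add_mem h₁ h₂
  | single i r =>
    have : (Finsupp.single i r : I →₀ R) = r • Finsupp.single i 1 := by simp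
    rw [this, map_smul]
    exact Submodule.smul_mem _ _ (Submodule.subset_span ⟨Encodable.encode i, by simp⟩)

end Countable

/-! ### Filtrations with projective factors split. -/

section Projective

variable {R : Type u} [CommRing R] {M : Type u} [AddCommGroup M] [Module R M]

theorem exists_projective_complement {P Q : Submodule R M}
    [Module.Projective R (Q ⧸ P.submoduleOf Q)] :
    ∃ A : Submodule R M, A ≤ Q ∧ Disjoint A P ∧ Q ≤ P ⊔ A ∧ Module.Projective R A := by
  obtain ⟨s, hs⟩ := Module.projective_lifting_property (P.submoduleOf Q).mkQ LinearMap.id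
    (P.submoduleOf Q).mkQ_surjective
  have hs' : ∀ x, (P.submoduleOf Q).mkQ (s x) = x := fun x => LinearMap.congr_fun hs x
  have hinj : Function.Injective (Q.subtype ∘ₗ s) :=
    Q.subtype_injective.comp (Function.LeftInverse.injective hs')
  refine ⟨LinearMap.range (Q.subtype ∘ₗ s), ?_, ?_, ?_,
    Module.Projective.of_equiv (LinearEquiv.ofInjective _ hinj)⟩
  · rintro _ ⟨x, rfl⟩
    exact (s x).2
  · rw [Submodule.disjoint_def]
    rintro _ ⟨x, rfl⟩ hx
    have : (P.submoduleOf Q).mkQ (s x) = 0 := (Submodule.Quotient.mk_eq_zero _).2 hx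
    rw [hs'] at this
    rw [this, map_zero]
  · intro q hq
    let q' : Q := ⟨q, hq⟩
    let a : Q := s ((P.submoduleOf Q).mkQ q')
    have h1 : q' - a ∈ P.submoduleOf Q := by
      rw [← Submodule.Quotient.mk_eq_zero, ← Submodule.mkQ_apply, map_sub, hs', sub_self]
    have : q = ((q' - a : Q) : M) + a := by simp [q']
    rw [this]
    exact Submodule.add_mem_sup h1 ⟨_, rfl⟩

/-- A module filtered by projective modules is projective. -/
theorem IsContinuousChain.projective {σ : Ordinal.{u}} {F : Ordinal.{u} → Submodule R M}
    (h : IsContinuousChain σ F) (htop : F σ = ⊤)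
    (hfac : ∀ α < σ,
      Module.Projective R (F (Order.succ α) ⧸ (F α).submoduleOf (F (Order.succ α)))) :
    Module.Projective R M := by
  classical
  have hex : ∀ α : Set.Iio σ, ∃ A : Submodule R M, A ≤ F (Order.succ α.1) ∧ Disjoint A (F α) ∧
      F (Order.succ α.1) ≤ F α ⊔ A ∧ Module.Projective R A := fun α =>
    have := hfac α α.2
    exists_projective_complement
  choose A hA hdisj hsup hproj using hex
  have hind : iSupIndep A := by
    rw [iSupIndep_iff_finsetSum_eq_zero_imp_eq_zero]
    intro s
    -- In a vanishing sum, the term of largest index `a` lies both in `A a` and, being minus the sum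
    -- of the others, in `F a`.
    induction s using Finset.induction_on_max with
    | empty => simp
    | insert a s hmax ih =>
      intro v hv hv0
      have ha : a ∉ s := fun ha => lt_irrefl _ (hmax a ha)
      rw [Finset.sum_insert ha] at hv0
      have h1 : v a ∈ F a := by
        rw [eq_neg_of_add_eq_zero_left hv0]
        refine neg_mem (Submodule.sum_mem _ fun b hb => ?_)
        exact h.le (Order.succ_le_of_lt (hmax b hb)) (le_of_lt a.2)
          (hA b (hv b (Finset.mem_insert_of_mem hb)))
      have h2 : v a = 0 :=
        (Submodule.disjoint_def.1 (hdisj a)) _ (hv a (Finset.mem_insert_self a s)) h1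
      rw [h2, zero_add] at hv0
      intro b hb
      rcases Finset.mem_insert.1 hb with rfl | hb
      · exact h2
      · exact ih v (fun c hc => hv c (Finset.mem_insert_of_mem hc)) hv0 b hb
  have hspan : ∀ β ≤ σ, F β ≤ ⨆ α, A α := by
    intro β hβ
    induction β using SuccOrder.limitRecOn with
    | isMin β hmin =>
      obtain rfl : β = 0 := hmin.eq_bot
      rw [h.zero]
      exact bot_le
    | succ β _ ih =>
      have hβσ : β < σ := (Order.lt_succ β).trans_le hβ
      exact (hsup ⟨β, hβσ⟩).trans (sup_le (ih hβσ.le) (le_iSup A ⟨β, hβσ⟩))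
    | isSuccLimit β hlim ih =>
      rw [h.limit β hβ hlim]
      exact iSup_le fun α => ih α.1 α.2 (α.2.le.trans hβ)
  have htop' : ⨆ α, A α = ⊤ := by
    rw [eq_top_iff, ← htop]
    exact hspan σ le_rfl
  have hint := DirectSum.isInternal_submodule_of_iSupIndep_of_iSup_eq_top hind htop'
  exact Module.Projective.of_equiv (LinearEquiv.ofBijective (DirectSum.coeLinearMap A) hint)

end Projective

/-! ### Sets of size at most `κ` in any universe, which allows sets of ordinals. -/

section SmallSets

/-- A set is `κ`-small if it is covered by the range of a function on a type of cardinality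
at most `κ`. -/
def IsSmallSet (κ : Cardinal.{u}) {Ω : Type v} (S : Set Ω) : Prop :=
  ∃ (T : Type u) (f : T → Ω), #T ≤ κ ∧ S ⊆ Set.range f

variable {κ : Cardinal.{u}} {Ω : Type v}

theorem IsSmallSet.mono {S S' : Set Ω} (h : IsSmallSet κ S) (hS : S' ⊆ S) : IsSmallSet κ S' :=
  let ⟨T, f, hT, hf⟩ := h
  ⟨T, f, hT, hS.trans hf⟩

theorem isSmallSet_iff {Ω : Type u} {S : Set Ω} : IsSmallSet κ S ↔ #S ≤ κ := by
  constructor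
  · rintro ⟨T, f, hT, hf⟩
    exact (Cardinal.mk_le_mk_of_subset hf).trans (Cardinal.mk_range_le.trans hT)
  · intro h
    exact ⟨S, Subtype.val, h, by simp⟩

theorem isSmallSet_iUnion (hκ : ℵ₀ ≤ κ) {T : Type u} (hT : #T ≤ κ) {g : T → Set Ω}
    (hg : ∀ t, IsSmallSet κ (g t)) : IsSmallSet κ (⋃ t, g t) := by
  choose U f hU hf using hg
  refine ⟨Σ t, U t, fun p => f p.1 p.2, ?_, ?_⟩
  · rw [Cardinal.mk_sigma]
    refine (Cardinal.sum_le_sum _ _ hU).trans ?_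
    rw [Cardinal.sum_const, Cardinal.lift_id, Cardinal.lift_id]
    exact Cardinal.mul_le_of_le hκ hT le_rfl
  · refine Set.iUnion_subset fun t x hx => ?_
    obtain ⟨y, rfl⟩ := hf t hx
    exact ⟨⟨t, y⟩, rfl⟩

theorem IsSmallSet.biUnion (hκ : ℵ₀ ≤ κ) {Ω' : Type*} {S : Set Ω'} (hS : IsSmallSet κ S)
    {g : Ω' → Set Ω} (hg : ∀ s, IsSmallSet κ (g s)) : IsSmallSet κ (⋃ s ∈ S, g s) := by
  obtain ⟨T, f, hT, hf⟩ := hS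
  refine (isSmallSet_iUnion hκ hT fun t => hg (f t)).mono ?_
  refine Set.iUnion₂_subset fun s hs => ?_
  obtain ⟨t, rfl⟩ := hf hs
  exact Set.subset_iUnion (fun t => g (f t)) t

theorem isSmallSet_of_countable (hκ : ℵ₀ ≤ κ) {S : Set Ω} (hS : S.Countable) :
    IsSmallSet κ S := by
  rcases S.eq_empty_or_nonempty with rfl | hne
  · exact ⟨PEmpty, PEmpty.elim, by simp, by simp⟩
  · obtain ⟨f, rfl⟩ := hS.exists_eq_range hne
    exact ⟨ULift.{u} ℕ, fun n => f n.down, by simpa using hκ,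
      by rintro _ ⟨n, rfl⟩; exact ⟨⟨n⟩, rfl⟩⟩

theorem isSmallSet_iUnion_nat (hκ : ℵ₀ ≤ κ) {g : ℕ → Set Ω} (hg : ∀ n, IsSmallSet κ (g n)) :
    IsSmallSet κ (⋃ n, g n) := by
  have := IsSmallSet.biUnion hκ (isSmallSet_of_countable hκ (Set.countable_univ (α := ℕ))) hg
  simpa using this

theorem IsSmallSet.union (hκ : ℵ₀ ≤ κ) {S S' : Set Ω} (h : IsSmallSet κ S)
    (h' : IsSmallSet κ S') : IsSmallSet κ (S ∪ S') := by
  rw [Set.union_eq_iUnion]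
  have := isSmallSet_iUnion (κ := κ) (T := ULift.{u} Bool)
    (g := fun b => cond b.down S S') hκ ?_ ?_
  · refine this.mono (Set.iUnion_subset fun b => ?_)
    exact Set.subset_iUnion (fun b : ULift.{u} Bool => cond b.down S S') ⟨b⟩
  · exact (Cardinal.mk_lt_aleph0_iff.2 inferInstance).le.trans hκ
  · rintro ⟨_ | _⟩
    exacts [h', h]

theorem IsSmallSet.exists_closed (hκ : ℵ₀ ≤ κ) {S : Set Ω} (hS : IsSmallSet κ S)
    {d : Ω → Set Ω} (hd : ∀ a, IsSmallSet κ (d a)) :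
    ∃ S', S ⊆ S' ∧ IsSmallSet κ S' ∧ ∀ a ∈ S', d a ⊆ S' := by
  let U : ℕ → Set Ω := fun n => Nat.rec S (fun _ V => ⋃ a ∈ V, d a) n
  refine ⟨⋃ n, U n, Set.subset_iUnion U 0, isSmallSet_iUnion_nat hκ fun n => ?_, fun a ha => ?_⟩
  · induction n with
    | zero => exact hS
    | succ n ih => exact ih.biUnion hκ hd
  · obtain ⟨n, hn⟩ := Set.mem_iUnion.1 ha
    exact (Set.subset_biUnion_of_mem (u := d) hn).trans (Set.subset_iUnion U (n + 1))

end SmallSets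

/-! ### The Hill lemma. -/

section Hill

variable {R : Type u} [CommRing R] {C : Type u} [AddCommGroup C] [Module R C]

/-- A family of submodules of `C` which is closed under sums, contains enough `κ`-generated
submodules, and all of whose members have flat Mittag-Leffler quotients. -/
structure IsHillFamily (κ : Cardinal.{u}) (H : Set (Submodule R C)) : Prop where
  sSup_mem : ∀ 𝒮 ⊆ H, sSup 𝒮 ∈ H
  exists_mem : ∀ X : Set C, IsSmallSet κ X →
    ∃ P ∈ H, X ⊆ P ∧ ∃ Y : Set C, IsSmallSet κ Y ∧ P = Submodule.span R Y
  isFlatML : ∀ P ∈ H, IsFlatML R (C ⧸ P)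

/-- Images of successive submodules have the same factor if the kernel does not interfere. -/
noncomputable def factorMapEquiv {C' : Type u} [AddCommGroup C'] [Module R C'] (π : C →ₗ[R] C')
    {P Q : Submodule R C} (hPQ : P ≤ Q) (h : Q ⊓ LinearMap.ker π ≤ P) :
    (Q ⧸ P.submoduleOf Q) ≃ₗ[R] (Q.map π ⧸ (P.map π).submoduleOf (Q.map π)) := by
  let f : Q →ₗ[R] (Q.map π ⧸ (P.map π).submoduleOf (Q.map π)) :=
    ((P.map π).submoduleOf (Q.map π)).mkQ ∘ₗ π.submoduleMap Q
  have hf : Function.Surjective f :=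
    (Submodule.mkQ_surjective _).comp (π.submoduleMap_surjective Q)
  have hker : LinearMap.ker f = P.submoduleOf Q := by
    ext x
    rw [LinearMap.mem_ker]
    refine (Submodule.Quotient.mk_eq_zero _).trans ?_
    constructor
    · rintro ⟨p, hp, hpx⟩
      have hpx' : π p = π x := hpx
      have h1 : (x : C) - p ∈ P := h ⟨sub_mem x.2 (hPQ hp), by simp [hpx']⟩
      have h2 : (x : C) = (x - p) + p := by abel
      change (x : C) ∈ P
      rw [h2]
      exact add_mem h1 hp
    · intro hx
      exact ⟨x, hx, rfl⟩
  exact (Submodule.quotEquivOfEq _ _ hker.symm).trans (f.quotKerEquivOfSurjective hf)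

/-- Lift a presentation of the factor to `Q`: `Y` consists of the lifted generators, and `W` of the
lifted relations, which fall into `P` and span at least `P ⊓ span Y`. -/
theorem exists_generators_of_isLEPresented {κ : Cardinal.{u}} {P Q : Submodule R C}
    {N : Type u} [AddCommGroup N] [Module R N] (hN : IsLEPresented R κ N)
    (e : (Q ⧸ P.submoduleOf Q) ≃ₗ[R] N) :
    ∃ Y W : Set C, IsSmallSet κ Y ∧ IsSmallSet κ W ∧ Submodule.span R Y ≤ Q ∧
      Q ≤ P ⊔ Submodule.span R Y ∧ P ⊓ Submodule.span R Y ≤ Submodule.span R W ∧ W ⊆ P := by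
  obtain ⟨I, J, f, g, hI, hJ, hfg, hg⟩ := hN
  let π : Q →ₗ[R] N := e.toLinearMap ∘ₗ (P.submoduleOf Q).mkQ
  have hπ : Function.Surjective π := e.surjective.comp (Submodule.mkQ_surjective _)
  have hπ0 : ∀ q : Q, π q = 0 ↔ (q : C) ∈ P := by
    intro q
    refine (e.map_eq_zero_iff).trans ?_
    exact Submodule.Quotient.mk_eq_zero _
  obtain ⟨h, hh⟩ := Module.projective_lifting_property π g hπ
  have hh' : ∀ x, π (h x) = g x := fun x => LinearMap.congr_fun hh x
  let y : I → C := fun i => h (Finsupp.single i 1)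
  let w : J → C := fun j => h (f (Finsupp.single j 1))
  have hY : Submodule.span R (Set.range y) = LinearMap.range (Q.subtype ∘ₗ h) := by
    rw [← Finsupp.range_linearCombination]
    congr 1
    ext i
    simp [y]
  have hW : Submodule.span R (Set.range w) = LinearMap.range (Q.subtype ∘ₗ h ∘ₗ f) := by
    rw [← Finsupp.range_linearCombination]
    congr 1
    ext i
    simp [w]
  refine ⟨Set.range y, Set.range w, ⟨I, y, hI, subset_rfl⟩, ⟨J, w, hJ, subset_rfl⟩, ?_, ?_, ?_, ?_⟩
  · rw [hY]
    rintro _ ⟨x, rfl⟩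
    exact (h x).2
  · intro q hq
    obtain ⟨x, hx⟩ := hg (π ⟨q, hq⟩)
    rw [hY]
    have h1 : ((⟨q, hq⟩ - h x : Q) : C) ∈ P := by
      rw [← hπ0, map_sub, hh', hx, sub_self]
    have h2 : q = ((⟨q, hq⟩ - h x : Q) : C) + h x := by simp
    rw [h2]
    exact Submodule.add_mem_sup h1 ⟨x, rfl⟩
  · rw [hY, hW]
    rintro _ ⟨hP, x, rfl⟩
    have h1 : g x = 0 := by
      rw [← hh', hπ0]
      exact hP
    obtain ⟨z, rfl⟩ := (hfg x).1 h1
    exact ⟨z, rfl⟩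
  · rintro _ ⟨j, rfl⟩
    rw [SetLike.mem_coe, ← hπ0, hh']
    exact hfg.apply_apply_eq_zero _

section Filtration

variable {σ : Ordinal.{u}} {F : Ordinal.{u} → Submodule R C} {A : Ordinal.{u} → Submodule R C}

theorem IsContinuousChain.le_iSup (h : IsContinuousChain σ F)
    (hA : ∀ α < σ, F (Order.succ α) ≤ F α ⊔ A α) {β : Ordinal.{u}} (hβ : β ≤ σ) :
    F β ≤ ⨆ γ ∈ Set.Iio β, A γ := by
  induction β using SuccOrder.limitRecOn with
  | isMin β hmin =>
    obtain rfl : β = 0 := hmin.eq_bot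
    rw [h.zero]
    exact bot_le
  | succ β _ ih =>
    have hβσ : β < σ := (Order.lt_succ β).trans_le hβ
    refine (hA β hβσ).trans (sup_le ((ih hβσ.le).trans ?_) ?_)
    · exact biSup_mono fun γ (hγ : γ < β) => hγ.trans (Order.lt_succ β)
    · exact le_biSup A (Set.mem_Iio.2 (Order.lt_succ β))
  | isSuccLimit β hlim ih =>
    rw [h.limit β hβ hlim]
    refine iSup_le fun α => (ih α.1 α.2 (α.2.le.trans hβ)).trans ?_
    exact biSup_mono fun γ (hγ : γ < α.1) => hγ.trans α.2

/-- A set of indices such that the sum of the corresponding submodules `A α` meets the filtration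
in the expected way. -/
structure IsClosedSet (σ : Ordinal.{u}) (F A : Ordinal.{u} → Submodule R C)
    (S : Set Ordinal.{u}) : Prop where
  lt : ∀ α ∈ S, α < σ
  inf_le : ∀ α ∈ S, F α ⊓ A α ≤ ⨆ γ ∈ S ∩ Set.Iio α, A γ

theorem IsClosedSet.sUnion {𝒮 : Set (Set Ordinal.{u})} (h : ∀ S ∈ 𝒮, IsClosedSet σ F A S) :
    IsClosedSet σ F A (⋃₀ 𝒮) where
  lt := fun α ⟨S, hS, hα⟩ => (h S hS).lt α hα
  inf_le := fun α ⟨S, hS, hα⟩ => ((h S hS).inf_le α hα).trans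
    (biSup_mono fun _ hγ => ⟨⟨S, hS, hγ.1⟩, hγ.2⟩)

/-- Induction on the cutoff `β`: when `β ≥ α`, the `A β`-component of an element of `F α` lies in `F
β ⊓ A β`, and closedness of `S` rewrites it with smaller indices. -/
theorem IsClosedSet.inf_le_iSup {S : Set Ordinal.{u}} (hS : IsClosedSet σ F A S)
    (h : IsContinuousChain σ F) (hA : ∀ α < σ, A α ≤ F (Order.succ α))
    (α β : Ordinal.{u}) (hβ : β ≤ σ) :
    (⨆ γ ∈ S ∩ Set.Iio β, A γ) ⊓ F α ≤ ⨆ γ ∈ S ∩ Set.Iio α, A γ := by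
  induction β using SuccOrder.limitRecOn with
  | isMin β hmin =>
    obtain rfl : β = 0 := hmin.eq_bot
    simp
  | succ β _ ih =>
    have hβσ : β < σ := (Order.lt_succ β).trans_le hβ
    rcases lt_or_ge β α with hlt | hle
    · refine inf_le_left.trans (biSup_mono fun γ hγ => ⟨hγ.1, ?_⟩)
      exact (Order.lt_succ_iff.1 (Set.mem_Iio.1 hγ.2)).trans_lt hlt
    refine le_trans ?_ (ih hβσ.le)
    refine le_inf ?_ inf_le_right
    by_cases hβS : β ∈ S
    · rintro x ⟨hx, hxα⟩
      have hsplit : (⨆ γ ∈ S ∩ Set.Iio (Order.succ β), A γ) ≤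
          (⨆ γ ∈ S ∩ Set.Iio β, A γ) ⊔ A β := by
        refine iSup₂_le fun γ hγ => ?_
        rcases (Order.lt_succ_iff.1 (Set.mem_Iio.1 hγ.2)).lt_or_eq with h1 | rfl
        · exact (le_biSup A (⟨hγ.1, h1⟩ : γ ∈ S ∩ Set.Iio β)).trans le_sup_left
        · exact le_sup_right
      obtain ⟨y, hy, a, ha, rfl⟩ := Submodule.mem_sup.1 (hsplit hx)
      have hyF : y ∈ F β := by
        refine (iSup₂_le fun γ hγ => ?_ : (⨆ γ ∈ S ∩ Set.Iio β, A γ) ≤ F β) hy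
        have hγ2 : γ < β := hγ.2
        exact (hA γ (hγ2.trans hβσ)).trans (h.le (Order.succ_le_of_lt hγ2) hβσ.le)
      have haF : a ∈ F β := by
        have h1 := sub_mem (h.le hle hβσ.le hxα) hyF
        rwa [add_sub_cancel_left] at h1
      exact add_mem hy (hS.inf_le β hβS ⟨haF, ha⟩)
    · refine inf_le_left.trans (biSup_mono fun γ hγ => ⟨hγ.1, ?_⟩)
      refine (Order.lt_succ_iff.1 (Set.mem_Iio.1 hγ.2)).lt_of_ne ?_
      rintro rfl
      exact hβS hγ.1
  | isSuccLimit β hlim ih =>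
    rintro x ⟨hx, hxα⟩
    have : Nonempty (Set.Iio β) := ⟨⟨0, hlim.bot_lt⟩⟩
    have hdir : Directed (· ≤ ·) fun δ : Set.Iio β => ⨆ γ ∈ S ∩ Set.Iio δ.1, A γ := by
      refine Monotone.directed_le fun δ δ' hδ => ?_
      exact biSup_mono fun γ hγ => ⟨hγ.1, Set.mem_Iio.2 (lt_of_lt_of_le (Set.mem_Iio.1 hγ.2) hδ)⟩
    have hle : (⨆ γ ∈ S ∩ Set.Iio β, A γ) ≤
        ⨆ δ : Set.Iio β, ⨆ γ ∈ S ∩ Set.Iio δ.1, A γ := by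
      refine iSup₂_le fun γ hγ => ?_
      refine le_trans ?_ (_root_.le_iSup
        (fun δ : Set.Iio β => ⨆ γ ∈ S ∩ Set.Iio δ.1, A γ) ⟨Order.succ γ, hlim.succ_lt hγ.2⟩)
      exact le_biSup A (⟨hγ.1, Order.lt_succ γ⟩ : γ ∈ S ∩ Set.Iio (Order.succ γ))
    obtain ⟨δ, hδ⟩ := (Submodule.mem_iSup_of_directed _ hdir).1 (hle hx)
    exact ih δ.1 δ.2 (δ.2.le.trans hβ) ⟨hδ, hxα⟩

/-- The image of the filtration in the quotient has factor `0` at indices in `S` and the original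
factor at all others. -/
theorem IsClosedSet.isFlatML_quotient {S : Set Ordinal.{u}} (hS : IsClosedSet σ F A S)
    (h : IsContinuousChain σ F) (htop : F σ = ⊤) (hA : ∀ α < σ, A α ≤ F (Order.succ α))
    (hA' : ∀ α < σ, F (Order.succ α) ≤ F α ⊔ A α)
    (hfac : ∀ α < σ, IsFlatML R (F (Order.succ α) ⧸ (F α).submoduleOf (F (Order.succ α)))) :
    IsFlatML R (C ⧸ ⨆ γ ∈ S, A γ) := by
  set N : Submodule R C := ⨆ γ ∈ S, A γ with hN
  have hNσ : N = ⨆ γ ∈ S ∩ Set.Iio σ, A γ := by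
    rw [Set.inter_eq_left.2 fun α hα => Set.mem_Iio.2 (hS.lt α hα)]
  have hG : IsContinuousChain σ fun α => (F α).map N.mkQ :=
    { mono := fun α hα β hβ hαβ => Submodule.map_mono (h.mono hα hβ hαβ)
      zero := by simp [h.zero]
      limit := fun β hβ hlim => by rw [h.limit β hβ hlim, Submodule.map_iSup] }
  refine hG.isFlatML (by simp [htop]) fun α hα => ?_
  have hle := h.le (Order.le_succ α) (Order.succ_le_of_lt hα)
  by_cases hαS : α ∈ S
  · have heq : (F (Order.succ α)).map N.mkQ ≤ (F α).map N.mkQ := by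
      refine (Submodule.map_mono (hA' α hα)).trans ?_
      rw [Submodule.map_sup]
      refine sup_le le_rfl ?_
      have : A α ≤ N := le_biSup A hαS
      rw [Submodule.map_le_iff_le_comap]
      intro x hx
      have : N.mkQ x = 0 := (Submodule.Quotient.mk_eq_zero _).2 (this hx)
      rw [Submodule.mem_comap, this]
      exact zero_mem _
    have : Subsingleton ((F (Order.succ α)).map N.mkQ ⧸
        ((F α).map N.mkQ).submoduleOf ((F (Order.succ α)).map N.mkQ)) := by
      rw [Submodule.Quotient.subsingleton_iff, eq_top_iff]
      exact fun x _ => heq x.2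
    exact isFlatML_of_subsingleton
  · refine (hfac α hα).of_equiv (factorMapEquiv N.mkQ hle ?_).symm
    rw [Submodule.ker_mkQ, inf_comm, hNσ]
    refine (hS.inf_le_iSup h hA (Order.succ α) σ le_rfl).trans ?_
    refine iSup₂_le fun γ hγ => ?_
    have hγ2 : γ < α := by
      refine (Order.lt_succ_iff.1 (Set.mem_Iio.1 hγ.2)).lt_of_ne ?_
      rintro rfl
      exact hαS hγ.1
    exact (hA γ (hγ2.trans hα)).trans (h.le (Order.succ_le_of_lt hγ2) hα.le)

end Filtration

/-- Every `κ`-restricted flat Mittag-Leffler module has a Hill family. -/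
theorem exists_isHillFamily {κ : Cardinal.{u}} (hκ : ℵ₀ ≤ κ) {C : ModuleCat.{u} R}
    (hC : restrictedFlatML R κ C) : ∃ H : Set (Submodule R C), IsHillFamily κ H := by
  obtain ⟨σ, F, hmono, hzero, htop, hlim, hfac⟩ := hC
  have h : IsContinuousChain σ F := ⟨hmono, hzero, hlim⟩
  have hML : ∀ α < σ, IsFlatML R (F (Order.succ α) ⧸ (F α).submoduleOf (F (Order.succ α))) := by
    intro α hα
    obtain ⟨N, hN, ⟨e⟩⟩ := hfac α hα
    exact IsFlatML.of_equiv hN.2 e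
  have hgen : ∀ α, ∃ Y W : Set C, IsSmallSet κ Y ∧ IsSmallSet κ W ∧
      (α < σ → Submodule.span R Y ≤ F (Order.succ α) ∧
      F (Order.succ α) ≤ F α ⊔ Submodule.span R Y ∧ F α ⊓ Submodule.span R Y ≤ Submodule.span R W ∧
      W ⊆ F α) := by
    intro α
    by_cases hα : α < σ
    · obtain ⟨N, hN, ⟨e⟩⟩ := hfac α hα
      obtain ⟨Y, W, hY, hW, h1⟩ := exists_generators_of_isLEPresented hN.1 e
      exact ⟨Y, W, hY, hW, fun _ => h1⟩
    · exact ⟨∅, ∅, isSmallSet_of_countable hκ Set.countable_empty,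
        isSmallSet_of_countable hκ Set.countable_empty, fun h => absurd h hα⟩
  choose Y W hY hW hYW using hgen
  let A : Ordinal.{u} → Submodule R C := fun α => Submodule.span R (Y α)
  have hA : ∀ α < σ, A α ≤ F (Order.succ α) := fun α hα => (hYW α hα).1
  have hA' : ∀ α < σ, F (Order.succ α) ≤ F α ⊔ A α := fun α hα => (hYW α hα).2.1
  -- Each element of `F α` needs only finitely many `A γ` with `γ < α`. An index set is therefore
  -- closed as soon as it contains `D α w` for each of its members `α` and each `w ∈ W α`, and only
  -- `κ` many `w` occur for each `α`.
  have hD : ∀ (α : Ordinal.{u}) (x : C), ∃ D : Set Ordinal.{u}, D.Finite ∧ D ⊆ Set.Iio α ∧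
      (α ≤ σ → x ∈ F α → x ∈ ⨆ γ ∈ D, A γ) := by
    intro α x
    by_cases hx : α ≤ σ ∧ x ∈ F α
    · have h1 := h.le_iSup hA' hx.1 hx.2
      rw [iSup_subtype', Submodule.mem_iSup_iff_exists_finset] at h1
      obtain ⟨s, hs⟩ := h1
      refine ⟨Subtype.val '' (s : Set (Set.Iio α)), s.finite_toSet.image _, ?_, fun _ _ => ?_⟩
      · rintro _ ⟨γ, -, rfl⟩
        exact γ.2
      · refine (iSup₂_le fun γ hγ => ?_ : (⨆ i ∈ s, A i) ≤ _) hs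
        exact le_biSup A (Set.mem_image_of_mem _ hγ)
    · exact ⟨∅, Set.finite_empty, Set.empty_subset _, fun h1 h2 => absurd ⟨h1, h2⟩ hx⟩
  choose D hDfin hDlt hDmem using hD
  refine ⟨{P | ∃ S, IsClosedSet σ F A S ∧ P = ⨆ γ ∈ S, A γ}, ?_, ?_, ?_⟩
  · intro 𝒮 h𝒮
    refine ⟨⋃₀ {S | IsClosedSet σ F A S ∧ (⨆ γ ∈ S, A γ) ∈ 𝒮},
      IsClosedSet.sUnion fun S hS => hS.1, ?_⟩
    refine le_antisymm (sSup_le fun P hP => ?_) (iSup₂_le fun γ hγ => ?_)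
    · obtain ⟨S, hS, rfl⟩ := h𝒮 hP
      exact biSup_mono fun γ hγ => ⟨S, ⟨hS, hP⟩, hγ⟩
    · obtain ⟨S, ⟨hS, hS'⟩, hγ⟩ := hγ
      exact (le_biSup A hγ).trans (le_sSup hS')
  · intro X hX
    obtain ⟨S, hXS, hSsmall, hSd⟩ := IsSmallSet.exists_closed (S := ⋃ x ∈ X, D σ x) hκ
      (hX.biUnion hκ fun x => isSmallSet_of_countable hκ (hDfin σ x).countable)
      (d := fun α => ⋃ w ∈ W α, D α w)
      (fun α => (hW α).biUnion hκ fun w => isSmallSet_of_countable hκ (hDfin α w).countable)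
    have hS' : IsClosedSet σ F A (S ∩ Set.Iio σ) := by
      refine ⟨fun α hα => hα.2, fun α hα => ?_⟩
      refine (hYW α hα.2).2.2.1.trans (Submodule.span_le.2 fun w hw => ?_)
      refine (biSup_mono fun γ hγ => ?_ : (⨆ γ ∈ D α w, A γ) ≤ _)
        (hDmem α w (le_of_lt hα.2) ((hYW α hα.2).2.2.2 hw))
      have h1 : γ < α := hDlt α w hγ
      exact ⟨⟨hSd α hα.1 (Set.mem_biUnion hw hγ), h1.trans hα.2⟩, h1⟩
    refine ⟨_, ⟨_, hS', rfl⟩, fun x hx => ?_, ⋃ γ ∈ S ∩ Set.Iio σ, Y γ,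
      (hSsmall.mono Set.inter_subset_left).biUnion hκ hY, ?_⟩
    · refine (biSup_mono fun γ hγ => ?_ : (⨆ γ ∈ D σ x, A γ) ≤ _)
        (hDmem σ x le_rfl (by rw [htop]; trivial))
      exact ⟨hXS (Set.mem_biUnion hx hγ), hDlt σ x hγ⟩
    · rw [Submodule.span_iUnion₂]
  · rintro _ ⟨S, hS, rfl⟩
    exact hS.isFlatML_quotient h htop hA hA' hML

end Hill

/-! ### Free modules: the coordinate submodules form a Hill family for every infinite `κ`. -/

section Free

variable {R : Type u} [CommRing R] {ι : Type u}

theorem isFlatML_finsupp : IsFlatML R (ι →₀ R) := by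
  classical
  refine ⟨inferInstance, isMittagLeffler_iff_detects.2 fun I N _ _ x hx => ?_⟩
  have key : ∀ (j : I) (x : (ι →₀ R) ⊗[R] (∀ j, N j)) (i : ι),
      TensorProduct.finsuppScalarLeft R (N j) ι ((LinearMap.proj j).lTensor _ x) i =
        TensorProduct.finsuppScalarLeft R (∀ j, N j) ι x i j := by
    intro j x i
    induction x with
    | zero => simp
    | tmul f n => simp [TensorProduct.finsuppScalarLeft_apply_tmul_apply]
    | add x y hx hy => simp [hx, hy]
  apply (TensorProduct.finsuppScalarLeft R (∀ j, N j) ι).injective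
  rw [map_zero]
  ext i j
  rw [← key, hx j]
  simp

theorem isHillFamily_supported {κ : Cardinal.{u}} (hκ : ℵ₀ ≤ κ) :
    IsHillFamily κ (Set.range fun S : Set ι => Finsupp.supported R R S) := by
  classical
  refine ⟨fun 𝒮 h𝒮 => ?_, fun X hX => ?_, ?_⟩
  · refine ⟨⋃ S : {S : Set ι // Finsupp.supported R R S ∈ 𝒮}, S.1, ?_⟩
    simp only
    rw [Finsupp.supported_iUnion]
    refine le_antisymm (iSup_le fun S => le_sSup S.2) (sSup_le fun P hP => ?_)
    obtain ⟨S, rfl⟩ := h𝒮 hP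
    exact le_iSup (fun S : {S : Set ι // Finsupp.supported R R S ∈ 𝒮} =>
      Finsupp.supported R R S.1) ⟨S, hP⟩
  · have hsmall : IsSmallSet κ (⋃ x ∈ X, (x.support : Set ι)) :=
      hX.biUnion hκ fun x => isSmallSet_of_countable hκ x.support.countable_toSet
    refine ⟨_, ⟨⋃ x ∈ X, (x.support : Set ι), rfl⟩, fun x hx => ?_,
      (fun i => Finsupp.single i 1) '' ⋃ x ∈ X, (x.support : Set ι), ?_,
      Finsupp.supported_eq_span_single _ _⟩
    · exact Set.subset_biUnion_of_mem (u := fun x : ι →₀ R => (x.support : Set ι)) hx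
    · rw [← Set.biUnion_of_singleton (_ '' _), Set.biUnion_image]
      exact hsmall.biUnion hκ fun i => isSmallSet_of_countable hκ (Set.countable_singleton _)
  · rintro _ ⟨S, rfl⟩
    let r : (ι →₀ R) →ₗ[R] (ι →₀ R) :=
      Finsupp.linearCombination R fun i => if i ∈ S then 0 else Finsupp.single i 1
    have hr : Finsupp.supported R R S ≤ LinearMap.ker r := by
      rw [Finsupp.supported_eq_span_single, Submodule.span_le]
      rintro _ ⟨i, hi, rfl⟩
      simp [r, hi]
    refine isFlatML_finsupp.of_pure (f := (Finsupp.supported R R S).liftQ r hr)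
      (IsPureInjective.of_leftInverse (g := (Finsupp.supported R R S).mkQ) ?_)
    ext i
    by_cases hi : i ∈ S
    · have : (Finsupp.single i 1 : ι →₀ R) ∈ Finsupp.supported R R S :=
        Finsupp.single_mem_supported R 1 hi
      simp [r, (Submodule.Quotient.mk_eq_zero _).2 this]
    · simp [r, hi]

end Free

/-! ### Closing a `ℤ`-indexed family of small sets under finitary operations. -/

section Closure

variable {R : Type u} [CommRing R]

theorem IsSmallSet.finsets {κ : Cardinal.{u}} (hκ : ℵ₀ ≤ κ) {Ω : Type u} {S : Set Ω}
    (hS : IsSmallSet κ S) : IsSmallSet κ {s : Finset Ω | (s : Set Ω) ⊆ S} := by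
  classical
  refine ⟨Finset S, fun t => t.map (Function.Embedding.subtype _),
    mk_finset_le hκ (isSmallSet_iff.1 hS), fun s hs => ?_⟩
  refine ⟨s.subtype (· ∈ S), ?_⟩
  refine (Finset.subtype_map _).trans ?_
  exact Finset.filter_true_of_mem fun x hx => hs hx

theorem IsSmallSet.image {κ : Cardinal.{u}} {Ω Ω' : Type u} {S : Set Ω}
    (hS : IsSmallSet κ S) (f : Ω → Ω') : IsSmallSet κ (f '' S) :=
  isSmallSet_iff.2 (Cardinal.mk_image_le.trans (isSmallSet_iff.1 hS))

variable {C : ℤ → Type u} [∀ n, AddCommGroup (C n)] [∀ n, Module R (C n)]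

/-- Simultaneous closure of a small family of sets under finitary operations, such that the
generated submodules belong to given Hill families. -/
theorem exists_closed_family {κ : Cardinal.{u}} (hκ : ℵ₀ ≤ κ) {H : ∀ n, Set (Submodule R (C n))}
    (hH : ∀ n, IsHillFamily κ (H n)) (f : ∀ n, C (n + 1) → C n)
    (g : ∀ n, Finset (C (n + 1)) → Set (C (n + 1)))
    (g' : ∀ n, Finset (C (n + 1)) → Set (C (n + 1 + 1)))
    (hg : ∀ n s, (g n s).Countable) (hg' : ∀ n s, (g' n s).Countable)
    {X : ∀ n, Set (C n)} (hX : ∀ n, IsSmallSet κ (X n)) :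
    ∃ Y : ∀ n, Set (C n), (∀ n, X n ⊆ Y n) ∧ (∀ n, IsSmallSet κ (Y n)) ∧
      (∀ n, Submodule.span R (Y n) ∈ H n) ∧ (∀ n, ∀ y ∈ Y (n + 1), f n y ∈ Y n) ∧
      ∀ n (s : Finset (C (n + 1))), (s : Set (C (n + 1))) ⊆ Y (n + 1) →
        g n s ⊆ Y (n + 1) ∧ g' n s ⊆ Y (n + 1 + 1) := by
  have hgen : ∀ n (Y : Set (C n)), ∃ (P : Submodule R (C n)) (G : Set (C n)), IsSmallSet κ G ∧
      (IsSmallSet κ Y → P ∈ H n ∧ Y ⊆ P ∧ P = Submodule.span R G) := by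
    intro n Y
    by_cases hY : IsSmallSet κ Y
    · obtain ⟨P, hP, hYP, G, hG, hPG⟩ := (hH n).exists_mem Y hY
      exact ⟨P, G, hG, fun _ => ⟨hP, hYP, hPG⟩⟩
    · exact ⟨⊥, ∅, isSmallSet_of_countable hκ Set.countable_empty, fun h => absurd h hY⟩
  choose P G hG hPG using hgen
  let sec : Set (Σ n, C n) → ∀ n, Set (C n) := fun U n => Sigma.mk n ⁻¹' U
  have hsec : ∀ U n, IsSmallSet κ U → IsSmallSet κ (sec U n) := fun U n hU =>
    isSmallSet_iff.2 ((Cardinal.mk_preimage_of_injective _ _ sigma_mk_injective).trans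
      (isSmallSet_iff.1 hU))
  have hZ : IsSmallSet κ (Set.univ : Set ℤ) := isSmallSet_of_countable hκ Set.countable_univ
  -- One round of closure, on all degrees at once: apply `f`, add generators of a Hill hull in each
  -- degree, and apply `g` and `g'` to all finite subsets.
  let Φ : Set (Σ n, C n) → Set (Σ n, C n) := fun U => U ∪ ⋃ n ∈ (Set.univ : Set ℤ),
    (((fun y => ⟨n, f n y⟩) '' sec U (n + 1)) ∪ (Sigma.mk n '' G n (sec U n)) ∪
      ⋃ s ∈ {s : Finset (C (n + 1)) | (s : Set (C (n + 1))) ⊆ sec U (n + 1)},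
        (Sigma.mk (n + 1) '' g n s ∪ Sigma.mk (n + 1 + 1) '' g' n s))
  have hΦ : ∀ U, IsSmallSet κ U → IsSmallSet κ (Φ U) := by
    intro U hU
    refine hU.union hκ (hZ.biUnion hκ fun n => ((((hsec U (n + 1) hU).image _).union hκ
      ((hG n _).image _)).union hκ (((hsec U (n + 1) hU).finsets hκ).biUnion hκ fun s => ?_)))
    exact isSmallSet_of_countable hκ (((hg n s).image _).union ((hg' n s).image _))
  have hΦle : ∀ U, U ⊆ Φ U := fun U => Set.subset_union_left
  have hΦf : ∀ U n, ∀ y ∈ sec U (n + 1), f n y ∈ sec (Φ U) n := fun U n y hy =>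
    Or.inr (Set.mem_biUnion (Set.mem_univ n) (Or.inl (Or.inl ⟨y, hy, rfl⟩)))
  have hΦG : ∀ U n, G n (sec U n) ⊆ sec (Φ U) n := fun U n y hy =>
    Or.inr (Set.mem_biUnion (Set.mem_univ n) (Or.inl (Or.inr ⟨y, hy, rfl⟩)))
  have hΦg : ∀ U n (s : Finset (C (n + 1))), (s : Set (C (n + 1))) ⊆ sec U (n + 1) →
      g n s ⊆ sec (Φ U) (n + 1) := fun U n s hs y hy =>
    Or.inr (Set.mem_biUnion (Set.mem_univ n) (Or.inr (Set.mem_biUnion hs (Or.inl ⟨y, hy, rfl⟩))))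
  have hΦg' : ∀ U n (s : Finset (C (n + 1))), (s : Set (C (n + 1))) ⊆ sec U (n + 1) →
      g' n s ⊆ sec (Φ U) (n + 1 + 1) := fun U n s hs y hy =>
    Or.inr (Set.mem_biUnion (Set.mem_univ n) (Or.inr (Set.mem_biUnion hs (Or.inr ⟨y, hy, rfl⟩))))
  clear_value Φ
  let V : ℕ → Set (Σ n, C n) := fun k =>
    Nat.rec (⋃ n ∈ (Set.univ : Set ℤ), Sigma.mk n '' X n) (fun _ U => Φ U) k
  have hV : ∀ k, IsSmallSet κ (V k) := by
    intro k
    induction k with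
    | zero => exact hZ.biUnion hκ fun n => (hX n).image _
    | succ k ih => exact hΦ _ ih
  have hVsucc : ∀ k, V (k + 1) = Φ (V k) := fun k => rfl
  have hVmono : Monotone V := monotone_nat_of_le_succ fun k => hΦle _
  have hV0 : ∀ n, X n ⊆ sec (V 0) n := fun n x hx =>
    Set.mem_biUnion (Set.mem_univ n) ⟨x, hx, rfl⟩
  clear_value V
  have hsecle : ∀ k n, sec (V k) n ⊆ sec (⋃ k, V k) n := fun k n =>
    Set.preimage_mono (Set.subset_iUnion V k)
  have hmem : ∀ n y, y ∈ sec (⋃ k, V k) n → ∃ k, y ∈ sec (V k) n := by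
    intro n y hy
    obtain ⟨k, hk⟩ := Set.mem_iUnion.1 (Set.mem_preimage.1 hy)
    exact ⟨k, hk⟩
  refine ⟨sec (⋃ k, V k), fun n => (hV0 n).trans (hsecle 0 n),
    fun n => hsec _ n (isSmallSet_iUnion_nat hκ hV), fun n => ?_, fun n y hy => ?_,
    fun n s hs => ?_⟩
  -- The stages and their Hill hulls interleave, so the span of the union is the supremum of the
  -- hulls and belongs to the Hill family.
  · have heq : Submodule.span R (sec (⋃ k, V k) n) =
        sSup (Set.range fun k => P n (sec (V k) n)) := by
      refine le_antisymm (Submodule.span_le.2 fun y hy => ?_) (sSup_le ?_)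
      · obtain ⟨k, hk⟩ := hmem n y hy
        exact le_sSup (Set.mem_range_self (f := fun k => P n (sec (V k) n)) k)
          ((hPG n _ (hsec _ n (hV k))).2.1 hk)
      · rintro _ ⟨k, rfl⟩
        simp only
        rw [(hPG n _ (hsec _ n (hV k))).2.2]
        refine Submodule.span_mono ((hΦG (V k) n).trans ?_)
        rw [← hVsucc]
        exact hsecle (k + 1) n
    rw [heq]
    refine (hH n).sSup_mem _ ?_
    rintro _ ⟨k, rfl⟩
    exact (hPG n _ (hsec _ n (hV k))).1
  · obtain ⟨k, hk⟩ := hmem _ y hy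
    apply hsecle (k + 1) n
    rw [hVsucc]
    exact hΦf _ n y hk
  · obtain ⟨k, hk⟩ : ∃ k, (s : Set (C (n + 1))) ⊆ sec (V k) (n + 1) := by
      have hdir : Directed (· ⊆ ·) fun k => sec (V k) (n + 1) :=
        Monotone.directed_le fun a b hab => Set.preimage_mono (hVmono hab)
      refine hdir.exists_mem_subset_of_finset_subset_biUnion ?_
      refine hs.trans ?_
      simp [sec]
    exact ⟨(hΦg _ n s hk).trans (by rw [← hVsucc]; exact hsecle _ _),
      (hΦg' _ n s hk).trans (by rw [← hVsucc]; exact hsecle _ _)⟩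

end Closure

/-! ### A criterion for the image of a coordinate submodule to be flat. -/

section FlatImage

variable {R : Type u} [CommRing R] {X Z : Type u} [AddCommGroup Z] [Module R Z]

/-- Lift the entries of a relation to vectors supported on a finite `s ⊆ Y` and apply `φ`. The new
vectors lift the same entries and satisfy the relation already in the free module, so their
coordinates, all indexed by `Y`, trivialize it. -/
theorem flat_map_supported {π : (X →₀ R) →ₗ[R] Z} {Y : Set X}
    (h : ∀ s : Finset X, (s : Set X) ⊆ Y → ∃ φ : (X →₀ R) →ₗ[R] (X →₀ R),
      (∀ y ∈ s, π (φ (Finsupp.single y 1)) = π (Finsupp.single y 1)) ∧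
      (∀ k ∈ Finsupp.supported R R (s : Set X), π k = 0 → φ k = 0) ∧
      ∀ y ∈ s, φ (Finsupp.single y 1) ∈ Finsupp.supported R R Y) :
    Module.Flat R ((Finsupp.supported R R Y).map π) := by
  classical
  refine Module.Flat.of_forall_isTrivialRelation fun {l f x} hfx => ?_
  choose k hk hkx using fun i => (x i).2
  let s : Finset X := Finset.univ.biUnion fun i => (k i).support
  have hs : (s : Set X) ⊆ Y := by
    intro y hy
    obtain ⟨i, -, hi⟩ := Finset.mem_biUnion.1 (Finset.mem_coe.1 hy)
    exact hk i hi
  have hks : ∀ i, k i ∈ Finsupp.supported R R (s : Set X) := by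
    intro i y hy
    exact Finset.mem_coe.2 (Finset.mem_biUnion.2 ⟨i, Finset.mem_univ i, hy⟩)
  obtain ⟨φ, h1, h2, h3⟩ := h s hs
  have hφ : ∀ i, π (φ (k i)) = x i := fun i => by
    rw [← hkx i]
    exact eq_of_mem_supported (f := π ∘ₗ φ) h1 (hks i)
  have hφY : ∀ i, φ (k i) ∈ Finsupp.supported R R Y := by
    intro i
    have := hks i
    rw [Finsupp.supported_eq_span_single] at this
    have hle : Submodule.span R ((fun i => Finsupp.single i (1 : R)) '' (s : Set X)) ≤
        (Finsupp.supported R R Y).comap φ := by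
      rw [Submodule.span_le]
      rintro _ ⟨y, hy, rfl⟩
      exact h3 y hy
    exact hle this
  have hzero : ∑ i, f i • φ (k i) = 0 := by
    have h4 := h2 (∑ i, f i • k i)
      (Submodule.sum_mem _ fun i _ => Submodule.smul_mem _ _ (hks i)) ?_
    · simpa using h4
    · have := congrArg Subtype.val hfx
      simpa [hkx] using this
  let t : Finset X := Finset.univ.biUnion fun i => (φ (k i)).support
  have htY : ∀ y ∈ t, y ∈ Y := by
    intro y hy
    obtain ⟨i, -, hi⟩ := Finset.mem_biUnion.1 hy
    exact hφY i hi
  rw [Module.isTrivialRelation_iff_vanishesTrivially]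
  refine TensorProduct.VanishesTrivially.of_fintype (κ := t) (fun i y => φ (k i) y)
    (fun y => ⟨π (Finsupp.single y.1 1), Finsupp.single y.1 1,
      Finsupp.single_mem_supported R 1 (htY y y.2), rfl⟩) (fun i => ?_) (fun y => ?_)
  · apply Subtype.ext
    rw [← hφ i]
    have hsum : φ (k i) = ∑ y ∈ t, φ (k i) y • Finsupp.single y 1 := by
      conv_lhs => rw [← Finsupp.sum_single (φ (k i))]
      rw [Finsupp.sum_of_support_subset (φ (k i)) (s := t)
        (fun y hy => Finset.mem_biUnion.2 ⟨i, Finset.mem_univ i, hy⟩) _ (by simp)]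
      simp
    have hsum' := congrArg π hsum
    rw [map_sum] at hsum'
    simp only [map_smul] at hsum'
    rw [hsum', ← Finset.sum_coe_sort t fun y => φ (k i) y • π (Finsupp.single y 1)]
    simp
  · have := DFunLike.congr_fun hzero y.1
    simpa [mul_comm] using this

end FlatImage

/-! ### Small subsequences of a sequence of short exact sequences. -/

section Step

variable {R : Type u} [CommRing R] {Z C : ℤ → Type u}
  [∀ n, AddCommGroup (Z n)] [∀ n, Module R (Z n)] [∀ n, AddCommGroup (C n)] [∀ n, Module R (C n)]

/-- A sequence of short exact sequences `0 → Z (n + 1) → C (n + 1) → Z n → 0`. -/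
structure IsSpliced (i : ∀ n, Z n →ₗ[R] C n) (p : ∀ n, C (n + 1) →ₗ[R] Z n) : Prop where
  inj : ∀ n, Function.Injective (i n)
  surj : ∀ n, Function.Surjective (p n)
  exact : ∀ n, Function.Exact (i (n + 1)) (p n)

variable {i : ∀ n, Z n →ₗ[R] C n} {p : ∀ n, C (n + 1) →ₗ[R] Z n}

theorem IsHillFamily.bot_mem {κ : Cardinal.{u}} {C : Type u} [AddCommGroup C] [Module R C]
    {H : Set (Submodule R C)} (hH : IsHillFamily κ H) : ⊥ ∈ H := by
  have := hH.sSup_mem ∅ (Set.empty_subset _)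
  rwa [sSup_empty] at this

theorem IsHillFamily.isFlatML_self {κ : Cardinal.{u}} {C : Type u} [AddCommGroup C] [Module R C]
    {H : Set (Submodule R C)} (hH : IsHillFamily κ H) : IsFlatML R C :=
  (hH.isFlatML ⊥ hH.bot_mem).of_equiv (Submodule.quotEquivOfEqBot ⊥ rfl).symm

theorem IsSpliced.isPureInjective (h : IsSpliced i p) (hZ : ∀ n, Module.Flat R (Z n)) (n : ℤ) :
    IsPureInjective (i n) := by
  obtain ⟨m, rfl⟩ : ∃ m, n = m + 1 := ⟨n - 1, by ring⟩
  have := hZ m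
  exact IsPureInjective.of_flat (h.inj _) (h.exact m) (h.surj m)

/-- If the `D n` have flat quotients and flat images, then the submodules they induce are pure. -/
theorem IsSpliced.isPureInjective_comap (h : IsSpliced i p) {D : ∀ n, Submodule R (C n)}
    (hD : ∀ n, Module.Flat R (C n ⧸ D n))
    (hflat : ∀ n, Module.Flat R ((D (n + 1)).map (p n))) (n : ℤ) :
    IsPureInjective ((D n).comap (i n)).subtype := by
  obtain ⟨m, rfl⟩ : ∃ m, n = m + 1 := ⟨n - 1, by ring⟩
  let a : (D (m + 1)).comap (i (m + 1)) →ₗ[R] D (m + 1) :=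
    (i (m + 1)).restrict fun _ hx => hx
  let b : D (m + 1) →ₗ[R] (D (m + 1)).map (p m) := (p m).submoduleMap _
  have ha : Function.Injective a := fun x y hxy =>
    Subtype.ext (h.inj _ (congrArg Subtype.val hxy))
  have hab : Function.Exact a b := by
    intro x
    constructor
    · intro hx
      obtain ⟨z, hz⟩ := (h.exact m x.1).1 (congrArg Subtype.val hx)
      exact ⟨⟨z, by rw [Submodule.mem_comap, hz]; exact x.2⟩, Subtype.ext hz⟩
    · rintro ⟨z, rfl⟩
      exact Subtype.ext ((h.exact m).apply_apply_eq_zero z.1)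
  have := hflat m
  have h1 : IsPureInjective a := IsPureInjective.of_flat ha hab ((p m).submoduleMap_surjective _)
  have := hD (m + 1)
  have h2 : IsPureInjective (D (m + 1)).subtype :=
    IsPureInjective.of_flat Subtype.val_injective (LinearMap.exact_subtype_mkQ _)
      (Submodule.mkQ_surjective _)
  apply IsPureInjective.of_comp (g := i (m + 1))
  have hcomm : i (m + 1) ∘ₗ ((D (m + 1)).comap (i (m + 1))).subtype =
      (D (m + 1)).subtype ∘ₗ a := by
    ext; rfl
  rw [hcomm]
  exact h2.comp h1

/-- Every small family of sets is contained in a `κ`-generated subsequence of short exact sequences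
with pure terms belonging to the Hill families. -/
theorem IsSpliced.exists_subsequence (h : IsSpliced i p) (hZ : ∀ n, Module.Flat R (Z n))
    {κ : Cardinal.{u}} (hκ : ℵ₀ ≤ κ) {H : ∀ n, Set (Submodule R (C n))}
    (hH : ∀ n, IsHillFamily κ (H n)) {X : ∀ n, Set (C n)} (hX : ∀ n, IsSmallSet κ (X n)) :
    ∃ D : ∀ n, Submodule R (C n), (∀ n, D n ∈ H n) ∧ (∀ n, X n ⊆ D n) ∧
      (∀ n, (D n).comap (i n) = (D (n + 1)).map (p n)) ∧
      (∀ n, IsPureInjective ((D n).comap (i n)).subtype) ∧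
      ∀ n, ∃ Y : Set (C n), IsSmallSet κ Y ∧ D n = Submodule.span R Y := by
  classical
  have hML : ∀ n, IsFlatML R (Z n) := fun n =>
    (hH n).isFlatML_self.of_pure (h.isPureInjective hZ n)
  let lc : ∀ n, (C n →₀ R) →ₗ[R] C n := fun n => Finsupp.linearCombination R id
  have hlc : ∀ n y, lc n (Finsupp.single y 1) = y := fun n y => by simp [lc]
  let π : ∀ n, (C (n + 1) →₀ R) →ₗ[R] Z n := fun n => p n ∘ₗ lc (n + 1)
  have hπ : ∀ n, Function.Surjective (π n) := fun n =>
    (h.surj n).comp fun y => ⟨Finsupp.single y 1, hlc _ y⟩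
  choose φ hφ hφ' using fun n s => (hML n).exists_endomorphism (hπ n) s
  -- Elements of the kernel of `p n` are hit from two degrees up; the value `0` elsewhere is never
  -- used.
  have hlift : ∀ n (u : C (n + 1)), ∃ c : C (n + 1 + 1), p n u = 0 →
      i (n + 1) (p (n + 1) c) = u := by
    intro n u
    by_cases hu : p n u = 0
    · obtain ⟨z, hz⟩ := (h.exact n u).1 hu
      obtain ⟨c, rfl⟩ := h.surj (n + 1) z
      exact ⟨c, fun _ => hz⟩
    · exact ⟨0, fun h => absurd h hu⟩
  choose ℓ hℓ using hlift
  -- Closure under `i ∘ p` gives a subcomplex, the supports of `φ n s y` give flat images, and the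
  -- lifts of `y - φ n s y` give exactness.
  obtain ⟨Y, hXY, hYsmall, hYH, hYf, hYg⟩ := exists_closed_family hκ hH
    (fun n y => i n (p n y))
    (fun n s => ⋃ y ∈ (s : Set (C (n + 1))),
      ((φ n s (Finsupp.single y 1)).support : Set (C (n + 1))))
    (fun n s => (fun y => ℓ n (y - lc _ (φ n s (Finsupp.single y 1)))) '' s)
    (fun n s => s.countable_toSet.biUnion fun y _ => Finset.countable_toSet _)
    (fun n s => s.countable_toSet.image _) hX
  have hspan : ∀ n, Submodule.span R (Y n) = (Finsupp.supported R R (Y n)).map (lc n) := by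
    intro n
    rw [Finsupp.supported_eq_span_single, Submodule.map_span, Set.image_image]
    congr 1
    simp [hlc]
  have hmap : ∀ n, (Submodule.span R (Y (n + 1))).map (p n) =
      (Finsupp.supported R R (Y (n + 1))).map (π n) := by
    intro n
    rw [hspan, ← Submodule.map_comp]
  have hflat : ∀ n, Module.Flat R ((Submodule.span R (Y (n + 1))).map (p n)) := by
    intro n
    rw [hmap]
    refine flat_map_supported fun s hs => ⟨φ n s, hφ n s, hφ' n s, fun y hy => ?_⟩
    exact (Set.subset_biUnion_of_mem (u := fun y =>
      ((φ n s (Finsupp.single y 1)).support : Set (C (n + 1)))) (Finset.mem_coe.2 hy)).trans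
        (hYg n s hs).1
  have hcm : ∀ n, (Submodule.span R (Y n)).comap (i n) =
      (Submodule.span R (Y (n + 1))).map (p n) := by
    intro n
    refine le_antisymm ?_ ?_
    · obtain ⟨m, rfl⟩ : ∃ m, n = m + 1 := ⟨n - 1, by ring⟩
      intro z hz
      rw [Submodule.mem_comap, hspan] at hz
      obtain ⟨k, hk, hkz⟩ := hz
      have hkY : (k.support : Set (C (m + 1))) ⊆ Y (m + 1) := hk
      have hks : k ∈ Finsupp.supported R R (k.support : Set (C (m + 1))) := by
        simp [Finsupp.mem_supported]
      have hπk : π m k = 0 := by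
        change p m (lc _ k) = 0
        rw [hkz]
        exact (h.exact m).apply_apply_eq_zero z
      -- Since `φ` kills `k`, the element `i z` equals the combination of the `y - φ y` with the
      -- coefficients of `k`, and each of these was provided with a preimage in `Y (m + 1 + 1)`.
      have h0 := hφ' m k.support k hks hπk
      let ψ : (C (m + 1) →₀ R) →ₗ[R] C (m + 1) := lc _ - lc _ ∘ₗ φ m k.support
      have hle : Submodule.span R ((fun i => Finsupp.single i (1 : R)) ''
          (k.support : Set (C (m + 1)))) ≤ (((Submodule.span R (Y (m + 1 + 1))).map
            (p (m + 1))).map (i (m + 1))).comap ψ := by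
        rw [Submodule.span_le]
        rintro _ ⟨y, hy, rfl⟩
        have hy0 : p m (y - lc _ (φ m k.support (Finsupp.single y 1))) = 0 := by
          have := hφ m k.support y hy
          simp only [π, LinearMap.comp_apply, hlc] at this
          rw [map_sub, this, sub_self]
        have hc := (hYg m k.support hkY).2 ⟨y, hy, rfl⟩
        refine ⟨_, ⟨_, Submodule.subset_span hc, rfl⟩, ?_⟩
        simp only [ψ, LinearMap.sub_apply, LinearMap.comp_apply, hlc]
        exact hℓ m _ hy0
      have hks' := hks
      rw [Finsupp.supported_eq_span_single] at hks'
      obtain ⟨z', hz', hzz'⟩ := hle hks'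
      have : ψ k = i (m + 1) z := by
        simp only [ψ, LinearMap.sub_apply, LinearMap.comp_apply, h0, map_zero, sub_zero, hkz]
      rw [this] at hzz'
      rw [← h.inj _ hzz']
      exact hz'
    · rw [Submodule.map_span, Submodule.span_le]
      rintro _ ⟨y, hy, rfl⟩
      exact Submodule.subset_span (hYf n y hy)
  refine ⟨fun n => Submodule.span R (Y n), hYH, fun n => (hXY n).trans Submodule.subset_span, hcm,
    h.isPureInjective_comap (fun n => ((hH n).isFlatML _ (hYH n)).1) hflat,
    fun n => ⟨Y n, hYsmall n, rfl⟩⟩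

end Step

/-! ### Passing to quotient sequences and enlarging a subsequence by a `≤ κ`-presented piece. -/

section RelativeStep

variable {R : Type u} [CommRing R]

theorem IsHillFamily.quotient {κ : Cardinal.{u}} {C : Type u} [AddCommGroup C]
    [Module R C] {H : Set (Submodule R C)} (hH : IsHillFamily κ H) {D : Submodule R C}
    (hD : D ∈ H) : IsHillFamily κ (Submodule.map D.mkQ '' H) := by
  refine ⟨fun 𝒮 h𝒮 => ?_, fun X hX => ?_, ?_⟩
  · refine ⟨sSup {P ∈ H | P.map D.mkQ ∈ 𝒮}, hH.sSup_mem _ fun P hP => hP.1, ?_⟩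
    rw [(Submodule.gc_map_comap D.mkQ).l_sSup]
    refine le_antisymm (iSup₂_le fun P hP => le_sSup hP.2) (sSup_le fun Q hQ => ?_)
    obtain ⟨P, hP, rfl⟩ := h𝒮 hQ
    exact le_iSup₂_of_le P ⟨hP, hQ⟩ le_rfl
  · obtain ⟨P, hP, hXP, Y, hY, rfl⟩ := hH.exists_mem _ (hX.image Quotient.out)
    refine ⟨_, ⟨_, hP, rfl⟩, fun x hx => ?_, D.mkQ '' Y, hY.image _, Submodule.map_span _ _⟩
    exact ⟨_, hXP ⟨x, hx, rfl⟩, Quotient.out_eq x⟩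
  · rintro _ ⟨P, hP, rfl⟩
    have hsup : D ⊔ P ∈ H := by
      rw [← sSup_pair]
      refine hH.sSup_mem _ ?_
      rintro _ (rfl | rfl)
      exacts [hD, hP]
    exact (hH.isFlatML _ hsup).of_equiv (Submodule.quotientQuotientEquivQuotientSup D P)

/-- The quotient by the preimage of a submodule of a quotient. -/
noncomputable def quotientComapMkQEquiv {M : Type u} [AddCommGroup M] [Module R M]
    (N : Submodule R M) (P : Submodule R (M ⧸ N)) :
    (M ⧸ P.comap N.mkQ) ≃ₗ[R] ((M ⧸ N) ⧸ P) :=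
  (Submodule.quotEquivOfEq _ _ (by rw [LinearMap.ker_comp, Submodule.ker_mkQ])).trans
    ((P.mkQ ∘ₗ N.mkQ).quotKerEquivOfSurjective
      (P.mkQ_surjective.comp N.mkQ_surjective))

/-- A submodule of a quotient is the factor of its preimage. -/
noncomputable def factorComapMkQEquiv {M : Type u} [AddCommGroup M] [Module R M]
    {N Q : Submodule R M} {P : Submodule R (M ⧸ N)} (hQ : Q = P.comap N.mkQ) :
    (Q ⧸ N.submoduleOf Q) ≃ₗ[R] P := by
  subst hQ
  let f : P.comap N.mkQ →ₗ[R] P := N.mkQ.restrict fun _ hx => hx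
  have hf : Function.Surjective f := by
    rintro ⟨x, hx⟩
    obtain ⟨y, rfl⟩ := N.mkQ_surjective x
    exact ⟨⟨y, hx⟩, rfl⟩
  have hker : LinearMap.ker f = N.submoduleOf (P.comap N.mkQ) := by
    ext x
    rw [LinearMap.mem_ker]
    exact Subtype.ext_iff.trans (Submodule.Quotient.mk_eq_zero _)
  exact (Submodule.quotEquivOfEq _ _ hker.symm).trans (f.quotKerEquivOfSurjective hf)

theorem isLEPresented_of_span {κ : Cardinal.{u}} (hκ : ℵ₀ ≤ κ) {M : Type u} [AddCommGroup M]
    [Module R M] {Y : Set M} (hY : IsSmallSet κ Y) (hML : IsFlatML R (Submodule.span R Y)) :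
    IsLEPresented R κ (Submodule.span R Y) := by
  refine hML.isLEPresented hκ (X := Y) (isSmallSet_iff.1 hY)
    (π := Finsupp.linearCombination R fun y => ⟨y, Submodule.subset_span y.2⟩) ?_
  rw [← LinearMap.range_eq_top, Finsupp.range_linearCombination, ← Submodule.span_span_coe_preimage]
  congr 1
  ext y
  constructor
  · rintro ⟨a, rfl⟩
    exact a.2
  · intro hy
    exact ⟨⟨y, hy⟩, rfl⟩

variable {Z C : ℤ → Type u}
  [∀ n, AddCommGroup (Z n)] [∀ n, Module R (Z n)] [∀ n, AddCommGroup (C n)] [∀ n, Module R (C n)]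
  {i : ∀ n, Z n →ₗ[R] C n} {p : ∀ n, C (n + 1) →ₗ[R] Z n}

/-- `D` belongs to the Hill families `H` and induces a subsequence of short exact sequences whose
cycles have flat quotients. -/
structure IsGoodFamily (i : ∀ n, Z n →ₗ[R] C n) (p : ∀ n, C (n + 1) →ₗ[R] Z n)
    (H : ∀ n, Set (Submodule R (C n))) (D : ∀ n, Submodule R (C n)) : Prop where
  mem : ∀ n, D n ∈ H n
  comap_eq : ∀ n, (D n).comap (i n) = (D (n + 1)).map (p n)
  flat : ∀ n, Module.Flat R (Z n ⧸ (D n).comap (i n))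

theorem IsGoodFamily.le_comap {H : ∀ n, Set (Submodule R (C n))} {D : ∀ n, Submodule R (C n)}
    (hD : IsGoodFamily i p H D) (n : ℤ) :
    D (n + 1) ≤ ((D n).comap (i n)).comap (p n) := by
  rw [hD.comap_eq, ← Submodule.map_le_iff_le_comap]

theorem IsSpliced.quotient (h : IsSpliced i p) {H : ∀ n, Set (Submodule R (C n))}
    {D : ∀ n, Submodule R (C n)} (hD : IsGoodFamily i p H D) :
    IsSpliced (fun n => Submodule.mapQ ((D n).comap (i n)) (D n) (i n) le_rfl)
      (fun n => Submodule.mapQ (D (n + 1)) ((D n).comap (i n)) (p n) (hD.le_comap n)) := by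
  refine ⟨fun n => ?_, fun n => ?_, fun n x => ?_⟩
  · rw [← LinearMap.ker_eq_bot, Submodule.ker_mapQ]
    exact Submodule.mkQ_map_self _
  · intro x
    obtain ⟨z, rfl⟩ := Submodule.mkQ_surjective _ x
    obtain ⟨c, rfl⟩ := h.surj n z
    exact ⟨Submodule.mkQ _ c, rfl⟩
  · obtain ⟨c, rfl⟩ := Submodule.mkQ_surjective _ x
    constructor
    · intro hc
      have hc' : p n c ∈ (D n).comap (i n) := (Submodule.Quotient.mk_eq_zero _).1 hc
      rw [hD.comap_eq] at hc'
      obtain ⟨d, hd, hdc⟩ := hc'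
      obtain ⟨z, hz⟩ := (h.exact n (c - d)).1 (by rw [map_sub, hdc, sub_self])
      refine ⟨Submodule.mkQ _ z, ?_⟩
      refine (Submodule.Quotient.eq _).2 ?_
      rw [hz, sub_sub_cancel_left]
      exact neg_mem hd
    · rintro ⟨z, hz⟩
      obtain ⟨z, rfl⟩ := Submodule.mkQ_surjective _ z
      rw [← hz]
      change Submodule.mkQ _ (p n (i (n + 1) z)) = 0
      rw [(h.exact n).apply_apply_eq_zero, map_zero]

/-- A good family can be enlarged by a `κ`-presented piece. -/
theorem IsGoodFamily.exists_next (h : IsSpliced i p)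
    {κ : Cardinal.{u}} (hκ : ℵ₀ ≤ κ) {H : ∀ n, Set (Submodule R (C n))}
    (hH : ∀ n, IsHillFamily κ (H n)) {D : ∀ n, Submodule R (C n)} (hD : IsGoodFamily i p H D) :
    ∃ D', IsGoodFamily i p H D' ∧ D ≤ D' ∧ (D ≠ ⊤ → D < D') ∧
      ∀ n, ∃ N : ModuleCat.{u} R, presentedFlatML R κ N ∧
        Nonempty (((D' n).comap (i n) ⧸
          ((D n).comap (i n)).submoduleOf ((D' n).comap (i n))) ≃ₗ[R] N) := by
  have hc : ∀ n, ∃ c : C n, D n ≠ ⊤ → c ∉ D n := by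
    intro n
    by_cases hn : D n = ⊤
    · exact ⟨0, fun h => absurd hn h⟩
    · obtain ⟨c, hc⟩ : ∃ c, c ∉ D n := by
        by_contra! hall
        exact hn (eq_top_iff.2 fun c _ => hall c)
      exact ⟨c, fun _ => hc⟩
  choose c hc using hc
  have hH' : ∀ n, IsHillFamily κ (Submodule.map (D n).mkQ '' H n) := fun n =>
    (hH n).quotient (hD.mem n)
  have hQ := h.quotient hD
  -- The subsequence is found in the quotient by `D` and pulled back; starting from the class of `c
  -- n` forces a proper enlargement wherever `D n ≠ ⊤`.
  obtain ⟨E, hE, hcE, hEcm, hEpure, hEgen⟩ := hQ.exists_subsequence hD.flat hκ hH'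
    (X := fun n => {(D n).mkQ (c n)})
    (fun n => isSmallSet_of_countable hκ (Set.countable_singleton _))
  have hZML : ∀ n, IsFlatML R (Z n ⧸ (D n).comap (i n)) := fun n =>
    (hH' n).isFlatML_self.of_pure (hQ.isPureInjective hD.flat n)
  have hle : D ≤ fun n => (E n).comap (D n).mkQ := fun n => Submodule.le_comap_mkQ _ _
  have hcomap : ∀ n, ((E n).comap (D n).mkQ).comap (i n) = Submodule.comap
      (Submodule.mkQ ((D n).comap (i n)))
      ((E n).comap (Submodule.mapQ ((D n).comap (i n)) (D n) (i n) le_rfl)) := fun n => rfl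
  refine ⟨fun n => (E n).comap (D n).mkQ, ⟨fun n => ?_, fun n => ?_, fun n => ?_⟩, hle,
    fun hne => ?_, fun n => ?_⟩
  · obtain ⟨P, hP, hPE⟩ := hE n
    rw [← hPE, Submodule.comap_map_mkQ, ← sSup_pair]
    refine (hH n).sSup_mem _ ?_
    rintro _ (rfl | rfl)
    exacts [hD.mem n, hP]
  · rw [hcomap, hEcm]
    ext z
    constructor
    · rintro ⟨x, hx, hxz⟩
      obtain ⟨a, rfl⟩ := Submodule.mkQ_surjective _ x
      have hxz' : p n a - z ∈ (D n).comap (i n) := (Submodule.Quotient.eq _).1 hxz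
      rw [hD.comap_eq] at hxz'
      obtain ⟨d, hd, hdz⟩ := hxz'
      refine ⟨a - d, ?_, by rw [map_sub, hdz]; abel⟩
      exact sub_mem (Submodule.mem_comap.2 hx) (hle (n + 1) hd)
    · rintro ⟨a, ha, rfl⟩
      exact ⟨_, ha, rfl⟩
  · rw [hcomap]
    have := hD.flat n
    have : Module.Flat R ((Z n ⧸ (D n).comap (i n)) ⧸
        (E n).comap (Submodule.mapQ ((D n).comap (i n)) (D n) (i n) le_rfl)) :=
      flat_quotient_of_pure (hEpure n) (LinearMap.exact_subtype_mkQ _)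
        (Submodule.mkQ_surjective _)
    exact Module.Flat.of_linearEquiv (quotientComapMkQEquiv _ _)
  · refine lt_of_le_of_ne hle fun heq => hne ?_
    funext n
    by_contra hn
    apply hc n hn
    rw [heq]
    exact hcE n rfl
  · have hML := (hZML n).of_pure (hEpure n)
    refine ⟨ModuleCat.of R ((E n).comap
      (Submodule.mapQ ((D n).comap (i n)) (D n) (i n) le_rfl)), ⟨?_, hML.1, hML.2⟩,
      ⟨factorComapMkQEquiv (hcomap n)⟩⟩
    -- The new cycles in degree `n` are the image of `E (n + 1)`, so they inherit its `κ`
    -- generators.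
    obtain ⟨Y, hY, hEY⟩ := hEgen (n + 1)
    have hspan := hEcm n
    rw [hEY, Submodule.map_span] at hspan
    change IsLEPresented R κ ((E n).comap
      (Submodule.mapQ ((D n).comap (i n)) (D n) (i n) le_rfl))
    rw [hspan] at hML ⊢
    exact isLEPresented_of_span hκ (hY.image _) hML

end RelativeStep

/-! ### Transfinite exhaustion, periodic modules, and projectivity for `κ = ℵ₀`. -/

section Iteration

variable {R : Type u} [CommRing R] {Z C : ℤ → Type u}
  [∀ n, AddCommGroup (Z n)] [∀ n, Module R (Z n)] [∀ n, AddCommGroup (C n)] [∀ n, Module R (C n)]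
  {i : ∀ n, Z n →ₗ[R] C n} {p : ∀ n, C (n + 1) →ₗ[R] Z n}

theorem comap_iSup_of_directed {M M' : Type u} [AddCommGroup M] [Module R M] [AddCommGroup M']
    [Module R M'] (f : M →ₗ[R] M') {ι : Type*} [Nonempty ι] {D : ι → Submodule R M'}
    (hD : Directed (· ≤ ·) D) : (⨆ a, D a).comap f = ⨆ a, (D a).comap f := by
  refine le_antisymm (fun x hx => ?_) (iSup_le fun a => Submodule.comap_mono (le_iSup D a))
  obtain ⟨a, ha⟩ := (Submodule.mem_iSup_of_directed D hD).1 hx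
  exact Submodule.mem_iSup_of_mem a ha

theorem IsGoodFamily.bot (h : IsSpliced i p) (hZ : ∀ n, Module.Flat R (Z n))
    {κ : Cardinal.{u}} {H : ∀ n, Set (Submodule R (C n))}
    (hH : ∀ n, IsHillFamily κ (H n)) : IsGoodFamily i p H ⊥ := by
  have hbot : ∀ n, (⊥ : Submodule R (C n)).comap (i n) = ⊥ := fun n =>
    LinearMap.ker_eq_bot.2 (h.inj n)
  refine ⟨fun n => (hH n).bot_mem, fun n => ?_, fun n => ?_⟩
  · simp only [Pi.bot_apply, hbot, Submodule.map_bot]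
  · have := hZ n
    exact Module.Flat.of_linearEquiv (Submodule.quotEquivOfEqBot _ (hbot n))

/-- Flatness of `Z n` translates flat quotients into pure submodules and back, and purity survives
directed unions. -/
theorem IsGoodFamily.iSup (hZ : ∀ n, Module.Flat R (Z n))
    {κ : Cardinal.{u}} {H : ∀ n, Set (Submodule R (C n))} (hH : ∀ n, IsHillFamily κ (H n))
    {ι : Type*} [Nonempty ι] {D : ι → ∀ n, Submodule R (C n)} (hdir : Directed (· ≤ ·) D)
    (hD : ∀ a, IsGoodFamily i p H (D a)) : IsGoodFamily i p H (⨆ a, D a) := by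
  have hdir' : ∀ n, Directed (· ≤ ·) fun a => D a n := fun n a b =>
    let ⟨c, hac, hbc⟩ := hdir a b
    ⟨c, hac n, hbc n⟩
  refine ⟨fun n => ?_, fun n => ?_, fun n => ?_⟩
  · rw [iSup_apply]
    refine (hH n).sSup_mem _ ?_
    rintro _ ⟨a, rfl⟩
    exact (hD a).mem n
  · rw [iSup_apply, iSup_apply, comap_iSup_of_directed _ (hdir' n), Submodule.map_iSup]
    exact iSup_congr fun a => (hD a).comap_eq n
  · rw [iSup_apply, comap_iSup_of_directed _ (hdir' n)]
    have hdir'' : Directed (· ≤ ·) fun a => (D a n).comap (i n) := fun a b =>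
      let ⟨c, hac, hbc⟩ := hdir' n a b
      ⟨c, Submodule.comap_mono hac, Submodule.comap_mono hbc⟩
    have := hZ n
    refine flat_quotient_of_pure (f := Submodule.subtype _)
      (isPureInjective_subtype_of_directed hdir''
        (_root_.le_iSup fun a => (D a n).comap (i n)) le_rfl fun a => ?_)
      (LinearMap.exact_subtype_mkQ _) (Submodule.mkQ_surjective _)
    have := (hD a).flat n
    exact IsPureInjective.of_flat Subtype.val_injective (LinearMap.exact_subtype_mkQ _)
      (Submodule.mkQ_surjective _)

/-- In a sequence of short exact sequences with flat cycles whose middle terms have Hill families,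
the cycles are `κ`-restricted flat Mittag-Leffler. -/
theorem IsSpliced.restrictedFlatML (h : IsSpliced i p) (hZ : ∀ n, Module.Flat R (Z n))
    {κ : Cardinal.{u}} (hκ : ℵ₀ ≤ κ) (hC : ∀ n, ∃ H : Set (Submodule R (C n)), IsHillFamily κ H)
    (n : ℤ) : restrictedFlatML R κ (ModuleCat.of R (Z n)) := by
  classical
  choose H hH using hC
  choose! next hgood hle hlt hfac using fun D (hD : IsGoodFamily i p H D) =>
    IsGoodFamily.exists_next h hκ hH hD
  -- The default `⊤` makes the operator strictly increasing below `⊤` on all families, as the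
  -- transfinite iteration requires; only good families are ever reached.
  let φ : (∀ n, Submodule R (C n)) → ∀ n, Submodule R (C n) := fun D =>
    if IsGoodFamily i p H D then next D else ⊤
  have hφ : ∀ D, IsGoodFamily i p H D → φ D = next D := fun D hD => if_pos hD
  have hφlt : ∀ D ≠ ⊤, D < φ D := by
    intro D hD
    by_cases hg : IsGoodFamily i p H D
    · rw [hφ D hg]
      exact hlt D hg hD
    · simp only [φ, if_neg hg]
      exact lt_top_iff_ne_top.2 hD
  have hφtop : φ ⊤ = ⊤ := by
    by_cases hg : IsGoodFamily i p H ⊤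
    · rw [hφ _ hg]
      exact top_le_iff.1 (hle _ hg)
    · simp only [φ, if_neg hg]
  have hφle : ∀ D, D ≤ φ D := by
    intro D
    by_cases hD : D = ⊤
    · rw [hD, hφtop]
    · exact (hφlt D hD).le
  let D : Ordinal.{u} → ∀ n, Submodule R (C n) := fun α => transfiniteIterate φ α ⊥
  have hmono : Monotone D := monotone_transfiniteIterate φ ⊥ hφle
  have hD0 : D 0 = ⊥ := transfiniteIterate_bot φ ⊥
  have hDsucc : ∀ α, D (Order.succ α) = φ (D α) := fun α =>
    transfiniteIterate_succ φ ⊥ α (not_isMax α)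
  have hDlim : ∀ β, Order.IsSuccLimit β → D β = ⨆ α : Set.Iio β, D α := fun β hβ =>
    transfiniteIterate_limit φ ⊥ β hβ
  obtain ⟨σ, hσ⟩ : ∃ σ, D σ = ⊤ := top_mem_range_transfiniteIterate φ ⊥ hφlt hφtop
    (not_injective_of_ordinal _)
  have hdir : ∀ β : Ordinal.{u}, Directed (· ≤ ·) fun α : Set.Iio β => D α := fun β =>
    Monotone.directed_le fun a b hab => hmono hab
  have hDgood : ∀ α, IsGoodFamily i p H (D α) := by
    intro α
    induction α using SuccOrder.limitRecOn with
    | isMin α hmin =>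
      obtain rfl : α = 0 := hmin.eq_bot
      rw [hD0]
      exact IsGoodFamily.bot h hZ hH
    | succ α _ ih =>
      rw [hDsucc, hφ _ ih]
      exact hgood _ ih
    | isSuccLimit α hlim ih =>
      have : Nonempty (Set.Iio α) := ⟨⟨0, hlim.bot_lt⟩⟩
      rw [hDlim α hlim]
      exact IsGoodFamily.iSup hZ hH (hdir α) fun a => ih a.1 a.2
  refine ⟨σ, fun α => (D α n).comap (i n), ?_, ?_, ?_, ?_, ?_⟩
  · exact fun α _ β _ hαβ => Submodule.comap_mono (hmono hαβ n)
  · simp only [hD0, Pi.bot_apply]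
    exact LinearMap.ker_eq_bot.2 (h.inj n)
  · simp only [hσ, Pi.top_apply]
    exact Submodule.comap_top _
  · intro β _ hlim
    have : Nonempty (Set.Iio β) := ⟨⟨0, hlim.bot_lt⟩⟩
    simp only
    rw [hDlim β hlim, iSup_apply]
    refine comap_iSup_of_directed _ fun a b => ?_
    obtain ⟨c, hac, hbc⟩ := hdir β a b
    exact ⟨c, hac n, hbc n⟩
  · intro α _
    obtain ⟨N, hN, e⟩ := hfac (D α) (hDgood α) n
    refine ⟨N, hN, ?_⟩
    rw [← hφ _ (hDgood α), ← hDsucc] at e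
    exact e

theorem filt_of_equiv {S : ObjectProperty (ModuleCat.{u} R)} {M M' : ModuleCat.{u} R}
    (hM : filt S M) (e : M ≃ₗ[R] M') : filt S M' := by
  obtain ⟨σ, F, hmono, hzero, htop, hlim, hfac⟩ := hM
  refine ⟨σ, fun α => (F α).map e.toLinearMap, ?_, ?_, ?_, ?_, ?_⟩
  · exact fun α hα β hβ hαβ => Submodule.map_mono (hmono hα hβ hαβ)
  · simp [hzero]
  · simp [htop]
  · intro β hβ hβ'
    simp only
    rw [hlim β hβ hβ', Submodule.map_iSup]
  · intro α hα
    obtain ⟨N, hN, ⟨e'⟩⟩ := hfac α hα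
    refine ⟨N, hN, ⟨(factorMapEquiv e.toLinearMap ?_ ?_).symm.trans e'⟩⟩
    · exact hmono hα.le (Order.succ_le_of_lt hα) (Order.le_succ α)
    · simp

theorem restrictedFlatML_of_isPeriodic {κ : Cardinal.{u}} (hκ : ℵ₀ ≤ κ) {M : ModuleCat.{u} R}
    (hM : flatModules R M) (hper : IsPeriodic (restrictedFlatML R κ) M) :
    restrictedFlatML R κ M := by
  obtain ⟨C, f, g, hC, hf, hfg, hg⟩ := hper
  have h : IsSpliced (Z := fun _ => M) (C := fun _ => C) (fun _ => f) (fun _ => g) :=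
    ⟨fun _ => hf, fun _ => hg, fun _ => hfg⟩
  exact h.restrictedFlatML (fun _ => hM) hκ (fun _ => exists_isHillFamily hκ hC) 0

/-- With `q ∘ s = id`, the complementary idempotents `s ∘ q` and `1 - s ∘ q` of a free module
alternate as differentials of an exact sequence whose degree `0` cycles are isomorphic to `M`. -/
theorem restrictedFlatML_of_projective {κ : Cardinal.{u}} (hκ : ℵ₀ ≤ κ) {M : ModuleCat.{u} R}
    (hM : Module.Projective R M) : restrictedFlatML R κ M := by
  obtain ⟨s, hs⟩ := Module.projective_def'.1 hM
  let q : (M →₀ R) →ₗ[R] M := Finsupp.linearCombination R id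
  have hqs : ∀ x, q (s x) = x := fun x => LinearMap.congr_fun hs x
  let e : ℤ → (M →₀ R) →ₗ[R] (M →₀ R) := fun n => if Even n then s ∘ₗ q else LinearMap.id - s ∘ₗ q
  have hee : ∀ n x, e n (e (n + 1) x) = 0 := by
    intro n x
    by_cases hn : Even n
    · have hn' : ¬ Even (n + 1) := by simpa [Int.even_add_one] using hn
      simp [e, hn, hn', hqs]
    · have hn' : Even (n + 1) := by simpa [Int.even_add_one] using hn
      simp [e, hn, hn', hqs]
  have hsum : ∀ n x, e n x + e (n + 1) x = x := by
    intro n x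
    by_cases hn : Even n
    · have hn' : ¬ Even (n + 1) := by simpa [Int.even_add_one] using hn
      simp [e, hn, hn']
    · have hn' : Even (n + 1) := by simpa [Int.even_add_one] using hn
      simp [e, hn, hn']
  have hex : ∀ n x, e n x = 0 ↔ x ∈ LinearMap.range (e (n + 1)) := by
    intro n x
    constructor
    · intro hx
      exact ⟨x, by simpa [hx] using hsum n x⟩
    · rintro ⟨y, rfl⟩
      exact hee n y
  have hidem : ∀ n x, e n (e n x) = e n x := by
    intro n x
    have h1 := congrArg (e n) (hsum n x)
    rwa [map_add, hee, add_zero] at h1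
  have h : IsSpliced (Z := fun n => LinearMap.range (e n)) (C := fun _ => (M →₀ R))
      (fun n => (LinearMap.range (e n)).subtype) (fun n => (e n).rangeRestrict) := by
    refine ⟨fun n => Subtype.val_injective, fun n => (e n).surjective_rangeRestrict,
      fun n x => ?_⟩
    refine (Subtype.ext_iff.trans (hex n x)).trans ?_
    exact ⟨fun hx => ⟨⟨x, hx⟩, rfl⟩, by rintro ⟨y, rfl⟩; exact y.2⟩
  have hflat : ∀ n, Module.Flat R (LinearMap.range (e n)) := fun n =>
    Module.Flat.of_retract (LinearMap.range (e n)).subtype (e n).rangeRestrict <| by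
      ext ⟨_, y, rfl⟩
      simp [hidem]
  have h0 := h.restrictedFlatML hflat hκ (fun _ => ⟨_, isHillFamily_supported hκ⟩) 0
  have hsinj : Function.Injective s := Function.LeftInverse.injective hqs
  have hrange : LinearMap.range (e 0) = LinearMap.range s := by
    have he0 : e 0 = s ∘ₗ q := by simp [e]
    rw [he0]
    exact LinearMap.range_comp_of_range_eq_top s
      (LinearMap.range_eq_top.2 fun x => ⟨s x, hqs x⟩)
  exact filt_of_equiv h0 ((LinearEquiv.ofEq _ _ hrange).trans
    (LinearEquiv.ofInjective s hsinj).symm)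

theorem projective_of_restrictedFlatML_aleph0 {M : ModuleCat.{u} R}
    (hM : restrictedFlatML R ℵ₀ M) : Module.Projective R M := by
  obtain ⟨σ, F, hmono, hzero, htop, hlim, hfac⟩ := hM
  have h : IsContinuousChain σ F := ⟨hmono, hzero, hlim⟩
  refine h.projective htop fun α hα => ?_
  obtain ⟨N, hN, ⟨e⟩⟩ := hfac α hα
  have : Module.Projective R N := IsFlatML.projective_of_isLEPresented hN.2 hN.1
  exact Module.Projective.of_equiv e.symm

theorem restrictedFlatML_aleph0_eq (R : Type u) [CommRing R] :
    restrictedFlatML R ℵ₀ = projectiveModules R := by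
  ext M
  exact ⟨projective_of_restrictedFlatML_aleph0, restrictedFlatML_of_projective le_rfl⟩

end Iteration

/-! ### Cycles of pure acyclic complexes and contractibility. -/

section Complexes

variable {R : Type u} [CommRing R] (C : ChainComplex (ModuleCat.{u} R) ℤ)

theorem mem_cycles_iff {n m : ℤ} (h : m + 1 = n) (x : C.X n) :
    x ∈ RestrictedFlatML.cycles C n ↔ (C.d n m).hom x = 0 := by
  obtain rfl : m = n - 1 := by omega
  exact LinearMap.mem_ker

/-- The differential, as a map to the cycles. -/
noncomputable def toCycles (n : ℤ) : C.X (n + 1) →ₗ[R] RestrictedFlatML.cycles C n :=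
  (C.d (n + 1) n).hom.codRestrict _ fun x => by
    rw [mem_cycles_iff C (sub_add_cancel n 1), ← LinearMap.comp_apply, ← ModuleCat.hom_comp,
      C.d_comp_d]
    rfl

theorem isSpliced_cycles (hC : C.Acyclic) :
    IsSpliced (fun n => (RestrictedFlatML.cycles C n).subtype) (toCycles C) := by
  refine ⟨fun n => Subtype.val_injective, fun n => ?_, fun n x => ?_⟩
  · rintro ⟨x, hx⟩
    have hex := hC n
    rw [HomologicalComplex.exactAt_iff' C (n + 1) n (n - 1) (by simp) (by simp),
      ShortComplex.moduleCat_exact_iff] at hex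
    obtain ⟨y, hy⟩ := hex x hx
    exact ⟨y, Subtype.ext hy⟩
  · refine Subtype.ext_iff.trans ((mem_cycles_iff C rfl x).symm.trans ?_)
    exact ⟨fun hx => ⟨⟨x, hx⟩, rfl⟩, by rintro ⟨y, rfl⟩; exact y.2⟩

variable {C}

/-- Purity enters through flatness of the cycles, which are pure in the flat components. -/
theorem restrictedFlatML_cycles {κ : Cardinal.{u}} (hκ : ℵ₀ ≤ κ) (hC : IsPureAcyclic C)
    (hX : ∀ n, restrictedFlatML R κ (C.X n)) (n : ℤ) :
    restrictedFlatML R κ (ModuleCat.of R (RestrictedFlatML.cycles C n)) := by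
  have hHill := fun n => exists_isHillFamily hκ (hX n)
  refine (isSpliced_cycles C hC.1).restrictedFlatML (fun m => ?_) hκ hHill n
  obtain ⟨H, hH⟩ := hHill m
  have := hH.isFlatML_self.1
  exact flat_of_pure (isPureSubmodule_iff.1 (hC.2 m))

/-- An acyclic complex with projective cycles is contractible. -/
theorem nonempty_homotopy_zero (hC : C.Acyclic)
    (hproj : ∀ n, Module.Projective R (RestrictedFlatML.cycles C n)) :
    Nonempty (Homotopy (𝟙 C) 0) := by
  have h := isSpliced_cycles C hC
  have hpcyc : ∀ n (z : RestrictedFlatML.cycles C (n + 1)), toCycles C n z = 0 := fun n z =>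
    (h.exact n).apply_apply_eq_zero z
  have hsec : ∀ n, ∃ s : RestrictedFlatML.cycles C n →ₗ[R] C.X (n + 1),
      ∀ z, toCycles C n (s z) = z := fun n =>
    have := hproj n
    let ⟨s, hs⟩ := Module.projective_lifting_property (toCycles C n) LinearMap.id (h.surj n)
    ⟨s, fun z => LinearMap.congr_fun hs z⟩
  choose s hs using hsec
  have hret : ∀ n, ∃ ρ : C.X n →ₗ[R] RestrictedFlatML.cycles C n, ∀ z : RestrictedFlatML.cycles C n,
      ρ z = z := by
    intro n
    obtain ⟨m, rfl⟩ : ∃ m, n = m + 1 := ⟨n - 1, by ring⟩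
    refine ⟨(LinearMap.id - s m ∘ₗ toCycles C m).codRestrict _ fun x => ?_, fun z => ?_⟩
    · apply Subtype.ext
      simp [hpcyc]
    · rw [mem_cycles_iff C rfl]
      have h1 : toCycles C m
          ((LinearMap.id - s m ∘ₗ toCycles C m : C.X (m + 1) →ₗ[R] _) x) = 0 := by
        simp [hs]
      exact congrArg Subtype.val h1
  choose ρ hρ using hret
  -- Subtracting from `s` its component along the cycles gives a section `t` with `t d = 1 - ρ`.
  -- Then `t ρ` is a contraction: `d (t ρ) = ρ` and `(t ρ) d = 1 - ρ`.
  have hsec' : ∀ n, ∃ t : RestrictedFlatML.cycles C n →ₗ[R] C.X (n + 1),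
      ∀ x, t (toCycles C n x) = x - ρ (n + 1) x := by
    intro n
    refine ⟨(LinearMap.id - (RestrictedFlatML.cycles C (n + 1)).subtype ∘ₗ ρ (n + 1)) ∘ₗ s n,
      fun x => ?_⟩
    obtain ⟨z, hz⟩ := (h.exact n (x - s n (toCycles C n x))).1 (by rw [map_sub, hs, sub_self])
    have h1 : x = z + s n (toCycles C n x) := by
      rw [← sub_eq_iff_eq_add]
      exact hz.symm
    have h2 : ρ (n + 1) x = z + ρ (n + 1) (s n (toCycles C n x)) := by
      conv_lhs => rw [h1, map_add, hρ]
    rw [h2]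
    simp only [LinearMap.comp_apply, LinearMap.sub_apply, LinearMap.id_apply,
      Submodule.subtype_apply, Submodule.coe_add]
    have h3 : (z : C.X (n + 1)) = x - s n (toCycles C n x) := hz
    rw [h3]
    abel
  choose t ht using hsec'
  let k : ∀ n, C.X n ⟶ C.X (n + 1) := fun n => ModuleCat.ofHom (t n ∘ₗ ρ n)
  have hpt : ∀ n z, toCycles C n (t n z) = z := by
    intro n z
    obtain ⟨x, rfl⟩ := h.surj n z
    rw [ht, map_sub, hpcyc, sub_zero]
  let hom : ∀ a b, C.X a ⟶ C.X b := fun a b =>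
    if hab : a + 1 = b then k a ≫ eqToHom (by rw [hab]) else 0
  have hhom : ∀ a, hom a (a + 1) = k a := fun a => by simp [hom]
  refine ⟨{ hom := hom, zero := fun a b hab => dif_neg hab, comm := fun n => ?_ }⟩
  obtain ⟨m, rfl⟩ : ∃ m, n = m + 1 := ⟨n - 1, by ring⟩
  rw [dNext_eq hom (show (ComplexShape.down ℤ).Rel (m + 1) m from rfl),
    prevD_eq hom (show (ComplexShape.down ℤ).Rel (m + 1 + 1) (m + 1) from rfl), hhom, hhom]
  ext x
  have h1 : t m (ρ m ((C.d (m + 1) m).hom x)) = x - ρ (m + 1) x := by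
    rw [← ht m x]
    congr 1
    exact hρ m (toCycles C m x)
  have h2 : (C.d (m + 1 + 1) (m + 1)).hom (t (m + 1) (ρ (m + 1) x)) = ρ (m + 1) x :=
    congrArg Subtype.val (hpt (m + 1) (ρ (m + 1) x))
  simp [k, h1, h2]

end Complexes

end RestrictedFlatML

open RestrictedFlatML in
theorem mainTheorem5 (R : Type u) [CommRing R] :
    (∀ κ : Cardinal.{u}, ℵ₀ ≤ κ →
      (∀ M : ModuleCat.{u} R, flatModules R M → IsPeriodic (restrictedFlatML R κ) M →
        restrictedFlatML R κ M) ∧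
      (∀ C : ChainComplex (ModuleCat.{u} R) ℤ, IsPureAcyclic C →
        (∀ n, restrictedFlatML R κ (C.X n)) →
        ∀ n, restrictedFlatML R κ (ModuleCat.of R (RestrictedFlatML.cycles C n)))) ∧
    restrictedFlatML R ℵ₀ = projectiveModules R ∧
    (∀ M : ModuleCat.{u} R, flatModules R M → IsPeriodic (projectiveModules R) M →
      projectiveModules R M) ∧
    (∀ C : ChainComplex (ModuleCat.{u} R) ℤ, IsPureAcyclic C →
      (∀ n, projectiveModules R (C.X n)) →
      (∀ n, projectiveModules R (ModuleCat.of R (RestrictedFlatML.cycles C n))) ∧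
      Nonempty (Homotopy (𝟙 C) 0)) := by
  refine ⟨fun κ hκ => ⟨fun M => restrictedFlatML_of_isPeriodic hκ,
    fun C hC hX => restrictedFlatML_cycles hκ hC hX⟩, restrictedFlatML_aleph0_eq R, ?_, ?_⟩
  · rw [← restrictedFlatML_aleph0_eq]
    exact fun M => restrictedFlatML_of_isPeriodic le_rfl
  · intro C hC hX
    have hcyc : ∀ n, projectiveModules R (ModuleCat.of R (RestrictedFlatML.cycles C n)) := by
      rw [← restrictedFlatML_aleph0_eq] at hX ⊢
      exact restrictedFlatML_cycles le_rfl hC hX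
    exact ⟨hcyc, nonempty_homotopy_zero hC.1 hcyc⟩
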